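/- Let $d\ge 1$, $\lambda>0$, $s>0$. Let $e_1,e_2,\dots$ be i.i.d. standard exponential random variables and let $Z^{(1)},Z^{(2)},\dots$ be i.i.d. $\mathbb{R}^d$-valued random variables, independent of $(e_j)_j$, with $\mathbb{P}(Z^{(1)}=0)=0$. Put $N(t)=\max\{n\ge 0:\sum_{j=1}^n e_j\le\lambda t\}$ and let $$X(t)=\sum_{i=1}^{N(t)}Z^{(i)},\qquad t\in[0,1),$$ be the associated compound Poisson process, viewed as a random element of the space $\mathbf{D}$ of piecewise constant functions $f:[0,1)\to\mathbb{R}^d$ with finitely many jumps which at a jump take the new value. Let $\rho(x,y)=\|x-y\|_\infty$ on $\mathbb{R}^d$ and $\rho_{\mathbf{D}}(f,g)=\int_0^1\|f(t)-g(t)\|_\infty\,dt$ on $\mathbf{D}$. For a random variable $Y$ in a space $E$ with distortion measure $\varrho$, and $r\ge 0$, let $$D^{(q)}(r\,|\,Y,\varrho,s)=\inf\Big\{\big(\mathbb{E}\min_{a\in\mathcal{C}}\varrho(Y,a)^s\big)^{1/s}:\ \mathcal{C}\subseteq E \text{ finite, non-empty},\ \log\#\mathcal{C}\le r\Big\}\in[0,\infty],$$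 let $d^{(q)}(\varepsilon\,|\,Y,\varrho,s)=\inf\{n\in\mathbb{N},\,n\ge1: D^{(q)}(\log n\,|\,Y,\varrho,s)\le\varepsilon\}\in\mathbb{N}\cup\{\infty\}$, and put $$\gamma=\limsup_{\varepsilon\downarrow0}\frac{\log d^{(q)}(\varepsilon\,|\,Z^{(1)},\rho,s)}{\log(1/\varepsilon)}\in[0,\infty].$$ Then, with $-\log\infty=-\infty$, $$\limsup_{r\to\infty}\frac{-\log D^{(q)}(r\,|\,X,\rho_{\mathbf{D}},s)}{\sqrt{\frac2s\,r\log r}}\le 1.$$ If additionally $\gamma=0$, then $$\lim_{r\to\infty}\frac{-\log D^{(q)}(r\,|\,X,\rho_{\mathbf{D}},s)}{\sqrt{\frac2s\,r\log r}}=1.$$ -/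

import Mathlib

open MeasureTheory ProbabilityTheory Filter Topology
open scoped ENNReal

noncomputable section

/-- The space `D([0,1[, E)` of piecewise constant functions `f : [0,1[ → E` with finitely many
jumps which, at a jump, take the new value: there is a finite set `J` of possible jump positions
such that `f u = f v` whenever the half-open interval `(u, v]` contains no point of `J`. -/
structure StepPath (E : Type*) where
  toFun : Set.Ico (0 : ℝ) 1 → E
  isStep : ∃ J : Finset ℝ, ∀ u v : Set.Ico (0 : ℝ) 1, u ≤ v →
    (∀ x ∈ J, ¬ ((u : ℝ) < x ∧ x ≤ (v : ℝ))) → toFun u = toFun v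

instance StepPath.instCoeFun (E : Type*) :
    CoeFun (StepPath E) (fun _ => Set.Ico (0 : ℝ) 1 → E) :=
  ⟨StepPath.toFun⟩

/-- The `σ`-field on `D([0,1[, E)` induced by the projections `f ↦ f t`. -/
instance StepPath.instMeasurableSpace (E : Type*) [MeasurableSpace E] :
    MeasurableSpace (StepPath E) :=
  MeasurableSpace.comap StepPath.toFun MeasurableSpace.pi

/-- The quantization error `D^{(q)}(r | X, ρ, s)`: the infimum, over all non-empty finite codebooks
`C` with `log #C ≤ r`, of `(E min_{a ∈ C} ρ(X, a)^s)^{1/s}`. Distortions and errors are regarded as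
elements of `[0, ∞]`. -/
def quantizationError {Ω E : Type*} [MeasurableSpace Ω] (P : Measure Ω) (X : Ω → E)
    (ρ : E → E → ℝ≥0∞) (s r : ℝ) : ℝ≥0∞ :=
  ⨅ (C : Finset E) (_ : C.Nonempty) (_ : Real.log (C.card : ℝ) ≤ r),
    (∫⁻ ω, (⨅ a ∈ C, ρ (X ω) a ^ s) ∂P) ^ (1 / s)

/-- `d^{(q)}(ε | X, ρ, s)`: the least `n ≥ 1` with `D^{(q)}(log n | X, ρ, s) ≤ ε`,
and `∞` if there is none. -/
def quantizationNumber {Ω E : Type*} [MeasurableSpace Ω] (P : Measure Ω) (X : Ω → E)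
    (ρ : E → E → ℝ≥0∞) (s ε : ℝ) : ℕ∞ :=
  ⨅ (n : ℕ) (_ : 1 ≤ n)
    (_ : quantizationError P X ρ s (Real.log (n : ℝ)) ≤ ENNReal.ofReal ε), (n : ℕ∞)

/-- The quantization dimension
`γ = limsup_{ε ↓ 0} log d^{(q)}(ε | X, ρ, s) / log (1/ε)`. -/
def quantizationDimension {Ω E : Type*} [MeasurableSpace Ω] (P : Measure Ω) (X : Ω → E)
    (ρ : E → E → ℝ≥0∞) (s : ℝ) : EReal :=
  limsup (fun ε : ℝ =>
      ENNReal.log ((quantizationNumber P X ρ s ε : ℕ∞) : ℝ≥0∞) / ((Real.log (1 / ε) : ℝ) : EReal))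
    (𝓝[>] (0 : ℝ))

/-- The norm distortion `ρ(x, y) = ‖x - y‖_∞` on `ℝ^d` (the norm of `Fin d → ℝ` is the maximum
norm). -/
def supDistortion (d : ℕ) (x y : Fin d → ℝ) : ℝ≥0∞ :=
  ENNReal.ofReal ‖x - y‖

/-- The distortion `ρ_D(f, g) = ∫_0^1 ρ(f(t), g(t)) dt` on `D([0,1[, E)`. -/
def pathDistortion {E : Type*} (ρ : E → E → ℝ≥0∞) (f g : StepPath E) : ℝ≥0∞ :=
  ∫⁻ t : Set.Ico (0 : ℝ) 1, ρ (f t) (g t) ∂(Measure.comap Subtype.val (volume : Measure ℝ))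

/-- The counting function `N(t) = max {n ≥ 0 : e_1 + ⋯ + e_n ≤ lam * t}`
(with `e_{j+1}` written `e j`). -/
def countingFunction (lam : ℝ) (e : ℕ → ℝ) (t : ℝ) : ℕ :=
  sSup {n : ℕ | ∑ j ∈ Finset.range n, e j ≤ lam * t}

/-- `X` is the compound Poisson process `X(t) = ∑_{i ≤ N(t)} Z^{(i)}`, `t ∈ [0,1[`, driven by the
i.i.d. standard exponential variables `e` through the Poisson process `N` with intensity `lam`, and
by the i.i.d. increments `Z`, independent of `e`, with `P(Z^{(1)} = 0) = 0`.
The variable `Z^{(i+1)}` is written `Z i`. -/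
structure IsCompoundPoisson {Ω : Type*} [MeasurableSpace Ω] (P : Measure Ω) {d : ℕ} (lam : ℝ)
    (e : ℕ → Ω → ℝ) (Z : ℕ → Ω → (Fin d → ℝ)) (X : Ω → StepPath (Fin d → ℝ)) : Prop where
  measurable_e : ∀ j, Measurable (e j)
  law_e : ∀ j, P.map (e j) = expMeasure 1
  indep_e : iIndepFun e P
  measurable_Z : ∀ i, Measurable (Z i)
  identDistrib_Z : ∀ i, IdentDistrib (Z i) (Z 0) P P
  indep_Z : iIndepFun Z P
  indep_e_Z : IndepFun (fun ω j => e j ω) (fun ω i => Z i ω) P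
  Z_ne_zero : ∀ᵐ ω ∂P, Z 0 ω ≠ 0
  measurable_X : Measurable X
  X_eq : ∀ᵐ ω ∂P, ∀ t : Set.Ico (0 : ℝ) 1,
    X ω t = ∑ i ∈ Finset.range (countingFunction lam (fun j => e j ω) (t : ℝ)), Z i ω

/-- Strong asymptotic bound `f ≲ g` as `r → ∞`: `limsup f / g ≤ 1`. -/
def AsympLe (f g : ℝ → EReal) : Prop :=
  limsup (fun r => f r / g r) atTop ≤ 1

/-- Strong asymptotic equivalence `f ∼ g` as `r → ∞`: `lim f / g = 1`. -/
def AsympEq (f g : ℝ → EReal) : Prop :=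
  Tendsto (fun r => f r / g r) atTop (𝓝 1)

end

/-! ### The counting function -/

/-! Write `g = √(2/s · r log r)`. Both bounds weigh the probability of seeing `n` jumps, about
`exp(-n log n)`, against the precision `exp(-r/n)` left for each jump time when `r` nats describe
`n` of them. The `s`-th power of the error is then of order `exp(-(n log n + s r / n))` for the
worst `n`. This `n` is near `√(2 s r / log r)`, where `log n ≈ (log r)/2`; both summands equal `s g
/ 2` and the error is `exp(-g)`.

Lower bound on the error: restrict to paths with one jump in each of `n` consecutive time cells and
jump sizes at least `κ`. Two such paths with the same jump sizes that are both `ε`-close to one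
codeword have all jump times within `2 ε / κ` of each other, so by volume a codeword serves a set of
probability `O(ε)^n` (`volume_jumpPathDistortion_le`). With `ε` of order `exp(-r/n) / n`, the
codebook misses half of the event (`IsCompoundPoisson.exists_le_lintegral_iInf`).

Upper bound when the dimension of the jump law is zero: describing a jump size to precision `1/y`
costs only `y^η` codewords, so time and size together cost `y^(1+η)` per jump
(`eventually_exists_coversJumps`). Take `y = exp(t r / n)` with `t < 1`, and unite the codebooks
over `n ≤ ⌈√r⌉`; the spare rate pays for the union. More jumps are so unlikely that the zero path
serves them. A Chernoff bound for the number of jumps and AM-GM over all `n`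
(`eventually_jump_exponent_le`) finish the estimate, and `t → 1` gives the constant. -/

theorem monotone_sum_range_of_nonneg {e : ℕ → ℝ} (he : ∀ j, 0 ≤ e j) :
    Monotone fun n => ∑ j ∈ Finset.range n, e j :=
  monotone_nat_of_le_succ fun n => by
    rw [Finset.sum_range_succ]; exact le_add_of_nonneg_right (he n)

/-- The bound `hm` matters: `sSup` of an unbounded set of naturals is `0`, so without it the
counting function could take a junk value. -/
theorem lt_countingFunction_iff {e : ℕ → ℝ} (he : ∀ j, 0 ≤ e j) {lam t : ℝ} {m i : ℕ}
    (hm : lam * t < ∑ j ∈ Finset.range m, e j) (h0 : 0 ≤ lam * t) :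
    i < countingFunction lam e t ↔ ∑ j ∈ Finset.range (i + 1), e j ≤ lam * t := by
  have hmono := monotone_sum_range_of_nonneg he
  have hbdd : BddAbove {n : ℕ | ∑ j ∈ Finset.range n, e j ≤ lam * t} := by
    refine ⟨m, fun n hn => ?_⟩
    by_contra! hlt
    exact absurd (hm.trans_le (hmono hlt.le)) (not_lt.2 hn)
  have hmem : ∑ j ∈ Finset.range (countingFunction lam e t), e j ≤ lam * t :=
    Nat.sSup_mem (s := {n : ℕ | ∑ j ∈ Finset.range n, e j ≤ lam * t}) ⟨0, by simpa using h0⟩ hbdd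
  exact ⟨fun h => (hmono (Nat.succ_le_of_lt h)).trans hmem,
    fun h => Nat.lt_of_succ_le (le_csSup hbdd h)⟩

/-- Turns a sum with random range into a fixed sum of step functions, one per jump, the form in
which paths are compared below. -/
theorem sum_range_countingFunction {V : Type*} [AddCommMonoid V] {e : ℕ → ℝ} (he : ∀ j, 0 ≤ e j)
    {lam t : ℝ} {n : ℕ} (hn : lam * t < ∑ j ∈ Finset.range (n + 1), e j) (h0 : 0 ≤ lam * t)
    (z : ℕ → V) :
    ∑ i ∈ Finset.range (countingFunction lam e t), z i =
      ∑ i ∈ Finset.range n,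
        if ∑ j ∈ Finset.range (i + 1), e j ≤ lam * t then z i else 0 := by
  have hle : countingFunction lam e t ≤ n := by
    by_contra! h
    exact absurd hn (not_lt.2 ((lt_countingFunction_iff he hn h0).1 h))
  rw [← Finset.sum_filter]
  congr 1
  ext i
  simp only [Finset.mem_range, Finset.mem_filter]
  rw [← lt_countingFunction_iff he hn h0]
  exact ⟨fun h => ⟨h.trans_le hle, h⟩, fun h => h.2⟩

/-! ### The exponential law -/

theorem expMeasure_one_le_volume : expMeasure 1 ≤ (volume : Measure ℝ) := by
  rw [expMeasure, gammaMeasure]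
  calc volume.withDensity (gammaPDF 1 1) ≤ volume.withDensity 1 := by
        refine withDensity_mono (ae_of_all _ fun x => ?_)
        change exponentialPDF 1 x ≤ 1
        rw [exponentialPDF_eq]
        refine ENNReal.ofReal_le_one.2 ?_
        split_ifs with h
        · simpa using h
        · exact zero_le_one
    _ = volume := withDensity_one

theorem smul_volume_restrict_le_expMeasure (b : ℝ) :
    ENNReal.ofReal (Real.exp (-b)) • (volume.restrict (Set.Icc 0 b)) ≤ expMeasure 1 := by
  rw [expMeasure, gammaMeasure, ← withDensity_const, ← withDensity_indicator measurableSet_Icc]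
  refine withDensity_mono (ae_of_all _ fun x => ?_)
  change _ ≤ exponentialPDF 1 x
  by_cases h : x ∈ Set.Icc 0 b
  · rw [Set.indicator_of_mem h, exponentialPDF_eq, if_pos h.1]
    refine ENNReal.ofReal_le_ofReal ?_
    simpa using h.2
  · rw [Set.indicator_of_notMem h]; exact zero_le

theorem ae_nonneg_expMeasure : ∀ᵐ x ∂(expMeasure 1), 0 ≤ x := by
  rw [ae_iff, expMeasure, gammaMeasure]
  simp only [not_le]
  rw [show {a : ℝ | a < 0} = Set.Iio 0 from rfl, withDensity_apply _ measurableSet_Iio]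
  exact lintegral_exponentialPDF_of_nonpos le_rfl

/-- The integrand times the density is `1 / (1 + θ)` times the exponential density of rate `1 + θ`.
-/
theorem lintegral_exp_neg_mul_expMeasure {θ : ℝ} (hθ : 0 ≤ θ) :
    ∫⁻ x, ENNReal.ofReal (Real.exp (-(θ * x))) ∂(expMeasure 1) = ENNReal.ofReal (1 / (1 + θ)) := by
  have hm : Measurable (exponentialPDF 1) := (measurable_exponentialPDFReal 1).ennreal_ofReal
  rw [expMeasure, gammaMeasure]
  change ∫⁻ x, _ ∂(volume.withDensity (exponentialPDF 1)) = _
  rw [lintegral_withDensity_eq_lintegral_mul _ hm (by fun_prop)]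
  have : ∀ x, (exponentialPDF 1 * fun x => ENNReal.ofReal (Real.exp (-(θ * x)))) x
      = ENNReal.ofReal (1 / (1 + θ)) * exponentialPDF (1 + θ) x := by
    intro x
    rw [Pi.mul_apply, exponentialPDF_eq, exponentialPDF_eq, ← ENNReal.ofReal_mul' (by positivity),
      ← ENNReal.ofReal_mul (by positivity)]
    congr 1
    split_ifs
    · rw [one_mul, ← Real.exp_add]
      field_simp
      ring_nf
    · simp
  simp_rw [this]
  have hm' : Measurable (exponentialPDF (1 + θ)) :=
    (measurable_exponentialPDFReal _).ennreal_ofReal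
  rw [lintegral_const_mul _ hm', lintegral_exponentialPDF_eq_one (by positivity), mul_one]

/-! ### Product measures -/

/-- The product outer measure is the largest one bounded by the product on boxes, hence monotone in
its factors without σ-finiteness. -/
theorem MeasureTheory.Measure.pi_le_pi {ι : Type*} [Fintype ι] {α : ι → Type*}
    [∀ i, MeasurableSpace (α i)] {μ ν : ∀ i, Measure (α i)} (h : ∀ i, μ i ≤ ν i) :
    Measure.pi μ ≤ Measure.pi ν := by
  refine Measure.le_iff.2 fun s hs => ?_
  rw [Measure.pi, Measure.pi, toMeasure_apply _ _ hs, toMeasure_apply _ _ hs]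
  have : OuterMeasure.pi (fun i => (μ i).toOuterMeasure) ≤
      OuterMeasure.pi (fun i => (ν i).toOuterMeasure) := by
    rw [OuterMeasure.le_pi]
    intro t _
    refine (OuterMeasure.pi_pi_le _ t).trans ?_
    exact Finset.prod_le_prod' fun i _ => h i (t i)
  exact this s

theorem MeasureTheory.Measure.pi_smul_restrict {ι : Type*} [Fintype ι] (c : ℝ≥0∞) (hc : c ≠ ∞)
    (I : Set ℝ) :
    Measure.pi (fun _ : ι => c • (volume : Measure ℝ).restrict I) =
      c ^ Fintype.card ι • (volume : Measure (ι → ℝ)).restrict (Set.univ.pi fun _ => I) := by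
  lift c to NNReal using hc
  have : SigmaFinite ((c : ℝ≥0∞) • (volume : Measure ℝ).restrict I) :=
    inferInstanceAs (SigmaFinite (c • (volume : Measure ℝ).restrict I))
  refine Measure.pi_eq fun s hs => ?_
  rw [volume_pi, Measure.restrict_pi_pi, Measure.smul_apply, Measure.pi_pi]
  simp [Finset.prod_mul_distrib]

/-! ### Partial sums as a linear map -/

/-- The matrix of the map `x ↦ (x 0 + ⋯ + x i)_i`. -/
def partialSumMatrix (m : ℕ) : Matrix (Fin m) (Fin m) ℝ := Matrix.of fun i j => if j ≤ i then 1 else 0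

theorem det_partialSumMatrix (m : ℕ) : (partialSumMatrix m).det = 1 := by
  rw [Matrix.det_of_isLowerTriangular]
  · simp [partialSumMatrix]
  · intro i j hij
    have : ¬ j ≤ i := by simpa using hij
    simp [partialSumMatrix, this]

theorem partialSumMatrix_mulVec {m : ℕ} (x : Fin m → ℝ) (i : Fin m) :
    (partialSumMatrix m).mulVec x i = ∑ j, if j ≤ i then x j else 0 := by
  simp [partialSumMatrix, Matrix.mulVec, dotProduct]

/-- The increment vectors whose partial sums lie in consecutive intervals of length `h`. -/
def spacedIncrements (m : ℕ) (h : ℝ) : Set (Fin m → ℝ) :=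
  {x | ∀ i : Fin m, (∑ j, if j ≤ i then x j else 0) ∈ Set.Ico (h * i) (h * (i + 1))}

theorem measurableSet_spacedIncrements (m : ℕ) (h : ℝ) : MeasurableSet (spacedIncrements m h) := by
  have : spacedIncrements m h = ⋂ i : Fin m,
      (fun x : Fin m → ℝ => ∑ j, if j ≤ i then x j else 0) ⁻¹' Set.Ico (h * i) (h * (i + 1)) := by
    ext x; simp [spacedIncrements]
  rw [this]
  refine MeasurableSet.iInter fun i => measurableSet_Ico.preimage ?_
  refine Finset.measurable_sum _ fun j _ => ?_
  split_ifs
  · exact measurable_pi_apply j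
  · exact measurable_const

/-- Taking partial sums is a unitriangular linear map, so it preserves volume, and the set is the
preimage of a box of side `h`. -/
theorem volume_spacedIncrements (m : ℕ) (h : ℝ) :
    volume (spacedIncrements m h) = ENNReal.ofReal h ^ m := by
  have hpre : spacedIncrements m h = (Matrix.toLin' (partialSumMatrix m)) ⁻¹'
      (Set.univ.pi fun i : Fin m => Set.Ico (h * i) (h * (i + 1))) := by
    ext x
    simp only [spacedIncrements, Set.mem_ofPred_eq, Set.mem_preimage, Matrix.toLin'_apply,
      Set.mem_univ_pi, partialSumMatrix_mulVec]
  have hdet : LinearMap.det (Matrix.toLin' (partialSumMatrix m)) = 1 := by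
    rw [LinearMap.det_toLin', det_partialSumMatrix]
  rw [hpre, Measure.addHaar_preimage_linearMap _ (by rw [hdet]; exact one_ne_zero), hdet,
    volume_pi_pi]
  simp only [Real.volume_Ico]
  ring_nf
  simp

/-- Sums lying in adjacent intervals of length `h` differ by at most `2 h`. On this cube the
exponential density is bounded below. -/
theorem spacedIncrements_subset {m : ℕ} {h : ℝ} :
    spacedIncrements m h ⊆ Set.univ.pi fun _ => Set.Icc 0 (2 * h) := by
  intro x hx i _
  have hi := hx i
  rcases Nat.eq_zero_or_pos (i : ℕ) with h0 | h0
  · have hsum : (∑ j, if j ≤ i then x j else 0) = x i := by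
      rw [Finset.sum_eq_single i]
      · simp
      · intro j _ hj
        have : ¬ j ≤ i := fun hle => hj (Fin.ext (by have : (j : ℕ) ≤ i := hle; omega))
        simp [this]
      · simp
    rw [hsum, h0] at hi
    simp only [Nat.cast_zero, mul_zero, zero_add, mul_one, Set.mem_Ico] at hi
    exact ⟨hi.1, by linarith⟩
  · let k : Fin m := ⟨i - 1, by omega⟩
    have hk := hx k
    have hsum : (∑ j, if j ≤ i then x j else 0) = (∑ j, if j ≤ k then x j else 0) + x i := by
      have : x i = ∑ j, if j = i then x j else 0 := by simp
      rw [this, ← Finset.sum_add_distrib]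
      refine Finset.sum_congr rfl fun j _ => ?_
      have h1 : j ≤ i ↔ (j : ℕ) ≤ i := Iff.rfl
      have h2 : j ≤ k ↔ (j : ℕ) ≤ i - 1 := Iff.rfl
      have h3 : j = i ↔ (j : ℕ) = i := Fin.ext_iff
      simp only [h1, h2, h3]
      split_ifs <;> first | omega | simp
    have hkc : ((k : ℕ) : ℝ) = i - 1 := by
      change (((i : ℕ) - 1 : ℕ) : ℝ) = _
      rw [Nat.cast_sub h0]; simp
    rw [hkc] at hk
    rw [hsum] at hi
    simp only [Set.mem_Ico] at hi hk
    constructor <;> nlinarith [hi.1, hi.2, hk.1, hk.2]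

theorem le_pi_expMeasure_spacedIncrements (m : ℕ) (h : ℝ) :
    (ENNReal.ofReal (Real.exp (-(2 * h))) * ENNReal.ofReal h) ^ m ≤
      Measure.pi (fun _ : Fin m => expMeasure 1) (spacedIncrements m h) := by
  calc _ = (ENNReal.ofReal (Real.exp (-(2 * h))) ^ Fintype.card (Fin m) •
        (volume : Measure (Fin m → ℝ)).restrict (Set.univ.pi fun _ => Set.Icc 0 (2 * h)))
        (spacedIncrements m h) := by
        rw [Measure.smul_apply, Measure.restrict_apply (measurableSet_spacedIncrements m h),
          Set.inter_eq_left.2 spacedIncrements_subset, volume_spacedIncrements, smul_eq_mul,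
          Fintype.card_fin, mul_pow]
    _ ≤ _ := by
        rw [← Measure.pi_smul_restrict _ ENNReal.ofReal_ne_top]
        exact Measure.pi_le_pi (fun _ => smul_volume_restrict_le_expMeasure _) _

/-! ### Step paths and the unit interval -/

/-- The path factors through the number of points of `J` passed so far, which takes values in `ℕ`,
where every function is measurable. -/
theorem StepPath.measurable {E : Type*} [MeasurableSpace E] (f : StepPath E) :
    Measurable f.toFun := by
  obtain ⟨J, hJ⟩ := f.isStep
  let k : Set.Ico (0 : ℝ) 1 → ℕ := fun t => ∑ x ∈ J, if x ≤ (t : ℝ) then 1 else 0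
  have hk : Measurable k := Finset.measurable_sum _ fun x _ =>
    Measurable.ite (measurableSet_le measurable_const measurable_subtype_coe)
      measurable_const measurable_const
  have key : ∀ u v : Set.Ico (0 : ℝ) 1, u ≤ v → k u = k v → f u = f v := by
    intro u v huv hkuv
    refine hJ u v huv fun x hx hlt => ?_
    have hne : k u < k v := by
      refine Finset.sum_lt_sum (fun y _ => ?_) ⟨x, hx, ?_⟩
      · by_cases h : y ≤ (u : ℝ)
        · have : y ≤ (v : ℝ) := h.trans huv
          simp [h, this]
        · simp [h]
      · simp [not_le.2 hlt.1, hlt.2]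
    omega
  have hfac : f.toFun.FactorsThrough k := by
    intro u v huv
    rcases le_total u v with h | h
    · exact key u v h huv
    · exact (key v u h huv.symm).symm
  have : f.toFun = (Function.extend k f.toFun fun _ => f ⟨0, by simp⟩) ∘ k := by
    ext t
    exact (hfac.extend_apply _ t).symm
  rw [this]
  exact (measurable_of_countable _).comp hk

/-- Lebesgue measure on the time interval `[0,1[`. -/
noncomputable abbrev timeMeasure : Measure (Set.Ico (0 : ℝ) 1) :=
  Measure.comap Subtype.val (volume : Measure ℝ)

theorem timeMeasure_Ico {a b : ℝ} (ha : 0 ≤ a) (hb : b ≤ 1) :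
    timeMeasure {t | a ≤ (t : ℝ) ∧ (t : ℝ) < b} = ENNReal.ofReal (b - a) := by
  rw [timeMeasure, comap_subtype_coe_apply measurableSet_Ico]
  have : (Subtype.val '' {t : Set.Ico (0 : ℝ) 1 | a ≤ (t : ℝ) ∧ (t : ℝ) < b}) = Set.Ico a b := by
    ext x
    constructor
    · rintro ⟨t, ht, rfl⟩
      exact ht
    · intro hx
      exact ⟨⟨x, ha.trans hx.1, hx.2.trans_le hb⟩, hx, rfl⟩
  rw [this, Real.volume_Ico]

instance isProbabilityMeasure_timeMeasure : IsProbabilityMeasure timeMeasure := by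
  constructor
  have := timeMeasure_Ico (le_refl 0) (le_refl 1)
  rw [sub_zero, ENNReal.ofReal_one] at this
  rw [← this]
  congr
  ext t
  exact iff_of_true (Set.mem_univ _) ⟨t.2.1, t.2.2⟩

/-! ### Paths with spaced jumps -/

section SpacedJumps

variable {d : ℕ}

/-- The `i`-th partial sum of the vector `x`. -/
noncomputable def partialSum {m : ℕ} (x : Fin m → ℝ) (i : Fin m) : ℝ := ∑ j, if j ≤ i then x j else 0

theorem partialSum_eq_sum_range {m : ℕ} (e : ℕ → ℝ) (i : Fin m) :
    partialSum (fun j : Fin m => e j) i = ∑ j ∈ Finset.range (i + 1), e j := by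
  have h := Fin.sum_univ_eq_sum_range (fun j => if j ≤ (i : ℕ) then e j else 0) m
  have h' : partialSum (fun j : Fin m => e j) i
      = ∑ j : Fin m, if (j : ℕ) ≤ (i : ℕ) then e j else 0 := rfl
  rw [h', h, ← Finset.sum_filter]
  congr 1
  ext j
  simp only [Finset.mem_filter, Finset.mem_range]
  omega

theorem partialSum_measurable {m : ℕ} (i : Fin m) :
    Measurable fun x : Fin m → ℝ => partialSum x i := by
  refine Finset.measurable_sum _ fun j _ => ?_
  split_ifs
  · exact measurable_pi_apply j
  · exact measurable_const

/-- The path with value jumps `z i` at the times where the partial sums of `x` are passed,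
`i < n`. -/
noncomputable def jumpPath (lam : ℝ) {n : ℕ} (x : Fin (n + 1) → ℝ) (z : ℕ → Fin d → ℝ) (t : ℝ) : Fin d → ℝ :=
  ∑ i : Fin n, if partialSum x i.castSucc ≤ lam * t then z i else 0

/-- The distance of the path `jumpPath lam x z` to `a`. -/
noncomputable def jumpPathDistortion (lam : ℝ) {n : ℕ} (a : StepPath (Fin d → ℝ))
    (x : Fin (n + 1) → ℝ) (z : ℕ → Fin d → ℝ) : ℝ≥0∞ :=
  ∫⁻ t : Set.Ico (0 : ℝ) 1, supDistortion d (jumpPath lam x z t) (a t) ∂timeMeasure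

theorem measurable_jumpPathDistortion (lam : ℝ) (n : ℕ) (a : StepPath (Fin d → ℝ)) :
    Measurable fun p : (Fin (n + 1) → ℝ) × (ℕ → Fin d → ℝ) =>
      jumpPathDistortion lam a p.1 p.2 := by
  refine Measurable.lintegral_prod_right' (f := fun q : ((Fin (n + 1) → ℝ) × (ℕ → Fin d → ℝ)) ×
    Set.Ico (0 : ℝ) 1 => supDistortion d (jumpPath lam q.1.1 q.1.2 q.2) (a q.2)) ?_
  refine ENNReal.measurable_ofReal.comp (measurable_norm.comp (Measurable.sub ?_ ?_))
  · refine Finset.measurable_sum _ fun i _ => ?_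
    refine Measurable.ite (measurableSet_le ?_ ?_) ?_ measurable_const
    · exact (partialSum_measurable _).comp (measurable_fst.comp measurable_fst)
    · exact (measurable_subtype_coe.comp measurable_snd).const_mul lam
    · exact (measurable_pi_apply _).comp (measurable_snd.comp measurable_fst)
  · exact a.measurable.comp measurable_snd

/-- The `k`-th jumps of both paths lie in the same cell. At a time between the two `i`-th jumps,
every other jump has therefore happened in both paths or in neither, and cancels. -/
theorem jumpPath_sub_jumpPath {lam : ℝ} {n : ℕ} {h : ℝ} (hh : 0 ≤ h) {x x' : Fin (n + 1) → ℝ}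
    (hx : x ∈ spacedIncrements (n + 1) h) (hx' : x' ∈ spacedIncrements (n + 1) h)
    (z : ℕ → Fin d → ℝ) (i : Fin n) {t : ℝ} (h1 : partialSum x i.castSucc ≤ lam * t)
    (h2 : lam * t < partialSum x' i.castSucc) :
    jumpPath lam x z t - jumpPath lam x' z t = z i := by
  rw [jumpPath, jumpPath, ← Finset.sum_sub_distrib, Finset.sum_eq_single i]
  · rw [if_pos h1, if_neg (not_le.2 h2), sub_zero]
  · intro k _ hk
    have hxk := hx k.castSucc
    have hxk' := hx' k.castSucc
    have hxi := hx i.castSucc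
    have hxi' := hx' i.castSucc
    change partialSum x _ ∈ _ at hxk
    change partialSum x' _ ∈ _ at hxk'
    change partialSum x _ ∈ _ at hxi
    change partialSum x' _ ∈ _ at hxi'
    simp only [Set.mem_Ico, Fin.val_castSucc] at hxk hxk' hxi hxi'
    rcases lt_or_gt_of_ne hk with hlt | hlt
    · have : ((k : ℕ) : ℝ) + 1 ≤ i := by exact_mod_cast hlt
      have := mul_le_mul_of_nonneg_left this hh
      rw [if_pos (by linarith), if_pos (by linarith), sub_self]
    · have : ((i : ℕ) : ℝ) + 1 ≤ k := by exact_mod_cast hlt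
      have := mul_le_mul_of_nonneg_left this hh
      rw [if_neg (by linarith), if_neg (by linarith), sub_self]
  · simp

/-- Between their `i`-th jumps the two paths are at distance `‖z i‖ ≥ κ`, while the triangle
inequality through `a` bounds their integrated distance by `2 ε`. The factor `lam` converts time to
partial sums. -/
theorem partialSum_sub_le {lam : ℝ} (hlam : 0 < lam) {n : ℕ} (hn : 1 ≤ n) {κ ε : ℝ} (hκ : 0 < κ)
    (hε : 0 ≤ ε)
    {x x' : Fin (n + 1) → ℝ} (hx : x ∈ spacedIncrements (n + 1) (lam / n))
    (hx' : x' ∈ spacedIncrements (n + 1) (lam / n)) {z : ℕ → Fin d → ℝ}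
    (hz : ∀ i : Fin n, κ ≤ ‖z i‖) {a : StepPath (Fin d → ℝ)}
    (ha : jumpPathDistortion lam a x z ≤ ENNReal.ofReal ε)
    (ha' : jumpPathDistortion lam a x' z ≤ ENNReal.ofReal ε) (i : Fin n) :
    partialSum x' i.castSucc - partialSum x i.castSucc ≤ 2 * lam * ε / κ := by
  have hn0 : (0 : ℝ) < n := by exact_mod_cast hn
  have hh : 0 ≤ lam / n := by positivity
  set A : Set (Set.Ico (0 : ℝ) 1) := {t | partialSum x i.castSucc / lam ≤ (t : ℝ) ∧
    (t : ℝ) < partialSum x' i.castSucc / lam} with hA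
  have hAm : MeasurableSet A :=
    (measurableSet_le measurable_const measurable_subtype_coe).inter
      (measurableSet_lt measurable_subtype_coe measurable_const)
  have h0 : 0 ≤ partialSum x i.castSucc / lam :=
    div_nonneg ((by positivity : (0 : ℝ) ≤ lam / n * _).trans (hx i.castSucc).1) hlam.le
  have h1 : partialSum x' i.castSucc / lam ≤ 1 := by
    rw [div_le_one hlam]
    refine (hx' i.castSucc).2.le.trans ?_
    have : ((i : ℕ) : ℝ) + 1 ≤ n := by exact_mod_cast i.2
    calc lam / n * (((i.castSucc : Fin (n + 1)) : ℕ) + 1) ≤ lam / n * n := by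
          rw [Fin.val_castSucc]; gcongr
      _ = lam := by field_simp
  -- If the jumps come in the other order, `A` is empty, `ENNReal.ofReal` truncates to `0`, and the
  -- claim still follows since its right side is nonnegative.
  have hμA := timeMeasure_Ico h0 h1
  have hmeas : Measurable fun t : Set.Ico (0 : ℝ) 1 =>
      supDistortion d (jumpPath lam x z t) (a t) := by
    refine ENNReal.measurable_ofReal.comp (measurable_norm.comp (Measurable.sub ?_ a.measurable))
    refine Finset.measurable_sum _ fun i _ => ?_
    exact Measurable.ite (measurableSet_le measurable_const
      (measurable_subtype_coe.const_mul lam)) measurable_const measurable_const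
  have key : ENNReal.ofReal κ * timeMeasure A ≤ ENNReal.ofReal (2 * ε) := by
    calc ENNReal.ofReal κ * timeMeasure A = ∫⁻ _ in A, ENNReal.ofReal κ ∂timeMeasure := by
          rw [setLIntegral_const]
      _ ≤ ∫⁻ t in A, (supDistortion d (jumpPath lam x z t) (a t) +
            supDistortion d (jumpPath lam x' z t) (a t)) ∂timeMeasure := by
          refine setLIntegral_mono' hAm fun t ht => ?_
          rw [supDistortion, supDistortion, ← ENNReal.ofReal_add (norm_nonneg _) (norm_nonneg _)]
          refine ENNReal.ofReal_le_ofReal ?_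
          have hdiff := jumpPath_sub_jumpPath hh hx hx' z i
            (by have := ht.1; rwa [div_le_iff₀' hlam] at this)
            (by have := ht.2; rwa [lt_div_iff₀' hlam] at this)
          calc κ ≤ ‖z i‖ := hz i
            _ = ‖(jumpPath lam x z t - a t) - (jumpPath lam x' z t - a t)‖ := by
                rw [sub_sub_sub_cancel_right, hdiff]
            _ ≤ _ := norm_sub_le _ _
      _ ≤ ∫⁻ t, (supDistortion d (jumpPath lam x z t) (a t) +
            supDistortion d (jumpPath lam x' z t) (a t)) ∂timeMeasure := setLIntegral_le_lintegral _ _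
      _ = jumpPathDistortion lam a x z + jumpPathDistortion lam a x' z := by
          rw [lintegral_add_left hmeas, jumpPathDistortion, jumpPathDistortion]
      _ ≤ ENNReal.ofReal ε + ENNReal.ofReal ε := add_le_add ha ha'
      _ = ENNReal.ofReal (2 * ε) := by rw [← ENNReal.ofReal_add hε hε, two_mul]
  rw [hA, hμA, ← ENNReal.ofReal_mul hκ.le, ENNReal.ofReal_le_ofReal_iff (by positivity),
    ← sub_div, ← mul_div_assoc, div_le_iff₀ hlam] at key
  rw [le_div_iff₀ hκ]
  linarith

theorem eq_partialSum_sub {m : ℕ} (x : Fin m → ℝ) (i : Fin m) :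
    x i = partialSum x i - if h : (i : ℕ) = 0 then 0 else
      partialSum x ⟨i - 1, by omega⟩ := by
  have hxi : x i = ∑ j, if j = i then x j else 0 := by simp
  have h1 : ∀ j : Fin m, j ≤ i ↔ (j : ℕ) ≤ i := fun _ => Iff.rfl
  have h3 : ∀ j : Fin m, j = i ↔ (j : ℕ) = i := fun _ => Fin.ext_iff
  split_ifs with h0
  · rw [sub_zero, hxi, partialSum]
    refine Finset.sum_congr rfl fun j _ => ?_
    simp only [h1, h3]
    split_ifs <;> first | omega | simp
  · rw [eq_sub_iff_add_eq, hxi, partialSum, partialSum, ← Finset.sum_add_distrib]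
    refine Finset.sum_congr rfl fun j _ => ?_
    have h2 : j ≤ (⟨i - 1, by omega⟩ : Fin m) ↔ (j : ℕ) ≤ i - 1 := Iff.rfl
    simp only [h1, h2, h3]
    split_ifs <;> first | omega | simp

/-- Volume is at most the product of the coordinate widths. Each of the first `n` increments is a
difference of two controlled partial sums, which doubles `2 lam ε / κ`. The last jump falls outside
the time interval, so only the trivial width `2 (lam / n)` is available there. -/
theorem volume_jumpPathDistortion_le {lam : ℝ} (hlam : 0 < lam) {n : ℕ} (hn : 1 ≤ n) {κ ε : ℝ}
    (hκ : 0 < κ) (hε : 0 ≤ ε) {z : ℕ → Fin d → ℝ} (hz : ∀ i : Fin n, κ ≤ ‖z i‖)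
    (a : StepPath (Fin d → ℝ)) :
    volume {x | x ∈ spacedIncrements (n + 1) (lam / n) ∧
        jumpPathDistortion lam a x z ≤ ENNReal.ofReal ε} ≤
      ENNReal.ofReal (4 * lam * ε / κ) ^ n * ENNReal.ofReal (2 * (lam / n)) := by
  refine (Real.volume_pi_le_prod_diam _).trans ?_
  rw [Fin.prod_univ_castSucc]
  refine mul_le_mul' ?_ ?_
  · calc _ ≤ ∏ _i : Fin n, ENNReal.ofReal (4 * lam * ε / κ) := by
          refine Finset.prod_le_prod' fun i _ => Metric.ediam_le ?_
          rintro _ ⟨x, hx, rfl⟩ _ ⟨x', hx', rfl⟩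
          rw [edist_dist, Real.dist_eq]
          refine ENNReal.ofReal_le_ofReal ?_
          simp only [Function.eval]
          have hb : ∀ k : Fin n,
              |partialSum x k.castSucc - partialSum x' k.castSucc| ≤ 2 * lam * ε / κ := fun k =>
            abs_sub_le_iff.2 ⟨partialSum_sub_le hlam hn hκ hε hx'.1 hx.1 hz hx'.2 hx.2 k,
              partialSum_sub_le hlam hn hκ hε hx.1 hx'.1 hz hx.2 hx'.2 k⟩
          have h4 : 4 * lam * ε / κ = 2 * lam * ε / κ + 2 * lam * ε / κ := by ring
          have hpos : 0 ≤ 2 * lam * ε / κ := by positivity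
          rw [eq_partialSum_sub x, eq_partialSum_sub x', h4]
          have hbi := hb i
          split_ifs with h0
          · rw [sub_zero, sub_zero]; linarith
          · have hbk := hb ⟨(i : ℕ) - 1, by omega⟩
            have hcast : (⟨(i.castSucc : ℕ) - 1, by omega⟩ : Fin (n + 1)) =
              (⟨(i : ℕ) - 1, by omega⟩ : Fin n).castSucc := rfl
            rw [hcast]
            rw [abs_le] at hbi hbk ⊢
            constructor <;> linarith [hbi.1, hbi.2, hbk.1, hbk.2]
      _ = _ := by simp
  · refine Metric.ediam_le ?_
    rintro _ ⟨x, hx, rfl⟩ _ ⟨x', hx', rfl⟩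
    rw [edist_dist, Real.dist_eq]
    refine ENNReal.ofReal_le_ofReal ?_
    have h1 := spacedIncrements_subset hx.1 (Fin.last n) trivial
    have h2 := spacedIncrements_subset hx'.1 (Fin.last n) trivial
    simp only [Function.eval]
    rw [abs_le]
    constructor <;> linarith [h1.1, h1.2, h2.1, h2.2]

end SpacedJumps

/-! ### Probability of the spaced-jump event and the volume argument -/

section LowerBound

variable {Ω : Type*} [MeasurableSpace Ω] {P : Measure Ω} {d : ℕ}
  {lam : ℝ} {e : ℕ → Ω → ℝ} {Z : ℕ → Ω → Fin d → ℝ} {X : Ω → StepPath (Fin d → ℝ)}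

theorem IsCompoundPoisson.ae_nonneg (hX : IsCompoundPoisson P lam e Z X) :
    ∀ᵐ ω ∂P, ∀ j, 0 ≤ e j ω := by
  rw [ae_all_iff]
  intro j
  have h := ae_nonneg_expMeasure
  rw [← hX.law_e j] at h
  exact ae_of_ae_map (hX.measurable_e j).aemeasurable h

theorem IsCompoundPoisson.measurable_fin_e (hX : IsCompoundPoisson P lam e Z X) (m : ℕ) :
    Measurable (fun ω (j : Fin m) => e j ω) :=
  measurable_pi_lambda _ fun j => hX.measurable_e j

theorem IsCompoundPoisson.measurable_Z_seq (hX : IsCompoundPoisson P lam e Z X) :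
    Measurable (fun ω i => Z i ω) :=
  measurable_pi_lambda _ fun j => hX.measurable_Z j

theorem IsCompoundPoisson.map_fin_e (hX : IsCompoundPoisson P lam e Z X) (m : ℕ) :
    P.map (fun ω (j : Fin m) => e j ω) = Measure.pi fun _ => expMeasure 1 := by
  have hind : iIndepFun (fun j : Fin m => e j) P := hX.indep_e.precomp Fin.val_injective
  rw [iIndepFun.map_fun_eq_pi_map (fun j : Fin m => (hX.measurable_e j).aemeasurable) hind]
  simp_rw [hX.law_e]

theorem IsCompoundPoisson.map_prod [IsProbabilityMeasure P] (hX : IsCompoundPoisson P lam e Z X) (m : ℕ) :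
    P.map (fun ω => ((fun j : Fin m => e j ω), fun i => Z i ω)) =
      (Measure.pi fun _ => expMeasure 1).prod (P.map fun ω i => Z i ω) := by
  have hind : IndepFun (fun ω (j : Fin m) => e j ω) (fun ω i => Z i ω) P := by
    have hm : Measurable fun (x : ℕ → ℝ) (j : Fin m) => x j :=
      measurable_pi_lambda _ fun j => measurable_pi_apply _
    exact hX.indep_e_Z.comp hm measurable_id
  rw [(indepFun_iff_map_prod_eq_prod_map_map (hX.measurable_fin_e m).aemeasurable
    hX.measurable_Z_seq.aemeasurable).1 hind, hX.map_fin_e]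

theorem IsCompoundPoisson.exists_half_le_norm [IsProbabilityMeasure P] (hX : IsCompoundPoisson P lam e Z X) :
    ∃ κ > 0, (2 : ℝ≥0∞)⁻¹ ≤ P {ω | κ ≤ ‖Z 0 ω‖} := by
  have hmono : Monotone fun k : ℕ => {ω | 1 / ((k : ℝ) + 1) ≤ ‖Z 0 ω‖} := by
    intro k l hkl ω (hω : 1 / ((k : ℝ) + 1) ≤ ‖Z 0 ω‖)
    have : (k : ℝ) ≤ l := by exact_mod_cast hkl
    have h2 : 1 / ((l : ℝ) + 1) ≤ 1 / ((k : ℝ) + 1) := by gcongr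
    exact h2.trans hω
  have hlim := tendsto_measure_iUnion_atTop (μ := P) hmono
  have hone : P (⋃ k : ℕ, {ω | 1 / ((k : ℝ) + 1) ≤ ‖Z 0 ω‖}) = 1 := by
    rw [← measure_univ (μ := P)]
    refine measure_congr (eventuallyEq_univ.2 ?_)
    filter_upwards [hX.Z_ne_zero] with ω hω
    obtain ⟨k, hk⟩ := exists_nat_one_div_lt (norm_pos_iff.2 hω)
    exact Set.mem_iUnion.2 ⟨k, hk.le⟩
  rw [hone] at hlim
  obtain ⟨k, hk⟩ := (hlim.eventually (lt_mem_nhds (ENNReal.one_half_lt_one))).exists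
  exact ⟨1 / ((k : ℝ) + 1), by positivity, hk.le⟩

/-- Increment sequences whose first `n` entries have norm at least `κ`. -/
def largeIncrements (d n : ℕ) (κ : ℝ) : Set (ℕ → Fin d → ℝ) := {z | ∀ i : Fin n, κ ≤ ‖z i‖}

theorem measurableSet_largeIncrements (d n : ℕ) (κ : ℝ) :
    MeasurableSet (largeIncrements d n κ) := by
  have : largeIncrements d n κ = ⋂ i : Fin n, {z : ℕ → Fin d → ℝ | κ ≤ ‖z i‖} := by
    ext z; simp [largeIncrements]
  rw [this]
  exact MeasurableSet.iInter fun i =>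
    measurableSet_le measurable_const (measurable_norm.comp (measurable_pi_apply _))

theorem IsCompoundPoisson.le_measure_largeIncrements (hX : IsCompoundPoisson P lam e Z X) {κ : ℝ}
    (hκ : (2 : ℝ≥0∞)⁻¹ ≤ P {ω | κ ≤ ‖Z 0 ω‖}) (n : ℕ) :
    (2 : ℝ≥0∞)⁻¹ ^ n ≤ P.map (fun ω i => Z i ω) (largeIncrements d n κ) := by
  have hS : MeasurableSet {v : Fin d → ℝ | κ ≤ ‖v‖} :=
    measurableSet_le measurable_const measurable_norm
  rw [Measure.map_apply hX.measurable_Z_seq (measurableSet_largeIncrements d n κ)]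
  have : (fun ω i => Z i ω) ⁻¹' largeIncrements d n κ =
      ⋂ i ∈ Finset.range n, Z i ⁻¹' {v | κ ≤ ‖v‖} := by
    ext ω
    simp only [largeIncrements, Set.mem_preimage, Set.mem_ofPred_eq, Set.mem_iInter,
      Finset.mem_range]
    exact ⟨fun h i hi => h ⟨i, hi⟩, fun h i => h i i.2⟩
  rw [this, hX.indep_Z.measure_inter_preimage_eq_mul (Finset.range n) fun _ _ => hS]
  calc (2 : ℝ≥0∞)⁻¹ ^ n = ∏ _i ∈ Finset.range n, (2 : ℝ≥0∞)⁻¹ := by simp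
    _ ≤ _ := Finset.prod_le_prod' fun i _ => by
        rw [(hX.identDistrib_Z i).measure_preimage_eq hS]; exact hκ

theorem IsCompoundPoisson.pathDistortion_eq_jumpPathDistortion
    (hX : IsCompoundPoisson P lam e Z X) (hlam : 0 < lam) {n : ℕ} (hn : 1 ≤ n) :
    ∀ᵐ ω ∂P, (fun j : Fin (n + 1) => e j ω) ∈ spacedIncrements (n + 1) (lam / n) →
      ∀ a : StepPath (Fin d → ℝ), pathDistortion (supDistortion d) (X ω) a =
        jumpPathDistortion lam a (fun j : Fin (n + 1) => e j ω) (fun i => Z i ω) := by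
  filter_upwards [hX.ae_nonneg, hX.X_eq] with ω he hω hsp a
  refine lintegral_congr fun t => ?_
  have hlast := (hsp (Fin.last n)).1
  change _ ≤ partialSum (fun j : Fin (n + 1) => e j ω) (Fin.last n) at hlast
  rw [partialSum_eq_sum_range (fun j => e j ω), Fin.val_last] at hlast
  have hn0 : (0 : ℝ) < n := by exact_mod_cast hn
  have hcancel : lam / n * n = lam := by field_simp
  rw [hcancel] at hlast
  have hlt : lam * (t : ℝ) < ∑ j ∈ Finset.range (n + 1), e j ω :=
    lt_of_lt_of_le (by nlinarith [t.2.2]) hlast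
  rw [hω t, sum_range_countingFunction he hlt (mul_nonneg hlam.le t.2.1)]
  congr 1
  rw [jumpPath, ← Fin.sum_univ_eq_sum_range
    (fun i => if ∑ j ∈ Finset.range (i + 1), e j ω ≤ lam * t then Z i ω else 0) n]
  refine Finset.sum_congr rfl fun i _ => ?_
  rw [partialSum_eq_sum_range (fun j => e j ω), Fin.val_castSucc]

/-- Remove from the spaced-jump event the parts `ε`-close to some codeword; on the rest the
distortion exceeds `ε`. Each removed part is measured with the jump sizes fixed, where the
exponential law is at most Lebesgue measure. -/
theorem IsCompoundPoisson.le_lintegral_iInf [IsProbabilityMeasure P] (hX : IsCompoundPoisson P lam e Z X) (hlam : 0 < lam)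
    {κ : ℝ} (hκ : 0 < κ) (hκ' : (2 : ℝ≥0∞)⁻¹ ≤ P {ω | κ ≤ ‖Z 0 ω‖}) {n : ℕ} (hn : 1 ≤ n)
    {s ε : ℝ} (hs : 0 ≤ s) (hε : 0 ≤ ε) (C : Finset (StepPath (Fin d → ℝ))) :
    ENNReal.ofReal ε ^ s *
        ((ENNReal.ofReal (Real.exp (-(2 * (lam / n)))) * ENNReal.ofReal (lam / n)) ^ (n + 1) *
          2⁻¹ ^ n -
          C.card * (ENNReal.ofReal (4 * lam * ε / κ) ^ n * ENNReal.ofReal (2 * (lam / n)))) ≤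
      ∫⁻ ω, (⨅ a ∈ C, pathDistortion (supDistortion d) (X ω) a ^ s) ∂P := by
  classical
  set Q := (Measure.pi fun _ : Fin (n + 1) => expMeasure 1).prod (P.map fun ω i => Z i ω) with hQ
  have := isProbabilityMeasure_expMeasure one_pos
  have hPZ : IsProbabilityMeasure (P.map fun ω i => Z i ω) :=
    Measure.isProbabilityMeasure_map hX.measurable_Z_seq.aemeasurable
  set A : Set ((Fin (n + 1) → ℝ) × (ℕ → Fin d → ℝ)) :=
    spacedIncrements (n + 1) (lam / n) ×ˢ largeIncrements d n κ with hA
  have hAm : MeasurableSet A :=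
    (measurableSet_spacedIncrements _ _).prod (measurableSet_largeIncrements _ _ _)
  set B : StepPath (Fin d → ℝ) → Set ((Fin (n + 1) → ℝ) × (ℕ → Fin d → ℝ)) := fun a =>
    A ∩ {p | jumpPathDistortion lam a p.1 p.2 ≤ ENNReal.ofReal ε} with hB
  have hBm : ∀ a, MeasurableSet (B a) := fun a =>
    hAm.inter (measurableSet_le (measurable_jumpPathDistortion lam n a) measurable_const)
  have hQA : (ENNReal.ofReal (Real.exp (-(2 * (lam / n)))) * ENNReal.ofReal (lam / n)) ^ (n + 1) *
      2⁻¹ ^ n ≤ Q A := by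
    rw [hQ, hA, Measure.prod_prod]
    exact mul_le_mul' (le_pi_expMeasure_spacedIncrements _ _) (hX.le_measure_largeIncrements hκ' n)
  have hQB : ∀ a, Q (B a) ≤
      ENNReal.ofReal (4 * lam * ε / κ) ^ n * ENNReal.ofReal (2 * (lam / n)) := by
    intro a
    rw [hQ, Measure.prod_apply_symm (hBm a)]
    refine (lintegral_mono (g := fun _ => ENNReal.ofReal (4 * lam * ε / κ) ^ n *
      ENNReal.ofReal (2 * (lam / n))) fun z => ?_).trans (by simp)
    by_cases hz : z ∈ largeIncrements d n κ
    · refine le_trans ?_ (volume_jumpPathDistortion_le hlam hn hκ hε hz a)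
      refine (Measure.pi_le_pi (fun _ => expMeasure_one_le_volume) _).trans ?_
      exact measure_mono fun x hx => ⟨hx.1.1, hx.2⟩
    · have : (fun x => (x, z)) ⁻¹' B a = ∅ := by
        ext x
        simp only [Set.mem_preimage, Set.mem_empty_iff_false, iff_false]
        exact fun h => hz h.1.2
      rw [this, measure_empty]
      exact zero_le
  set G := A \ ⋃ a ∈ C, B a with hG
  have hGm : MeasurableSet G := hAm.diff (C.measurableSet_biUnion fun a _ => hBm a)
  have hQG : Q A - ∑ a ∈ C, Q (B a) ≤ Q G :=
    (tsub_le_tsub_left (measure_biUnion_finset_le C B) _).trans le_measure_sdiff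
  have hφ : Measurable fun ω => ((fun j : Fin (n + 1) => e j ω), fun i => Z i ω) :=
    (hX.measurable_fin_e (n + 1)).prodMk hX.measurable_Z_seq
  calc _ ≤ ENNReal.ofReal ε ^ s * Q G := by
        refine mul_le_mul_right ((tsub_le_tsub hQA ?_).trans hQG) _
        calc ∑ a ∈ C, Q (B a) ≤ ∑ _a ∈ C, (ENNReal.ofReal (4 * lam * ε / κ) ^ n *
              ENNReal.ofReal (2 * (lam / n))) := Finset.sum_le_sum fun a _ => hQB a
          _ = _ := by rw [Finset.sum_const, nsmul_eq_mul]
    _ = ∫⁻ ω, ((fun ω => ((fun j : Fin (n + 1) => e j ω), fun i => Z i ω)) ⁻¹' G).indicator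
          (fun _ => ENNReal.ofReal ε ^ s) ω ∂P := by
        rw [lintegral_indicator_const (hGm.preimage hφ), ← Measure.map_apply hφ hGm,
          hX.map_prod]
    _ ≤ _ := by
        refine lintegral_mono_ae ?_
        filter_upwards [hX.pathDistortion_eq_jumpPathDistortion hlam hn] with ω hω
        refine Set.indicator_apply_le' (fun hωG => ?_) (fun _ => zero_le)
        refine le_iInf₂ fun a ha => ENNReal.rpow_le_rpow ?_ hs
        rw [hω hωG.1.1]
        by_contra! hlt
        exact hωG.2 (Set.mem_biUnion ha ⟨hωG.1, hlt.le⟩)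

end LowerBound

section LowerBound

variable {Ω : Type*} [MeasurableSpace Ω] {P : Measure Ω} [IsProbabilityMeasure P] {d : ℕ}
  {lam : ℝ} {e : ℕ → Ω → ℝ} {Z : ℕ → Ω → Fin d → ℝ} {X : Ω → StepPath (Fin d → ℝ)}

/-- The constants do not depend on `n`, `r` or the codebook, so `n` can still be chosen as a
function of `r`. -/
theorem IsCompoundPoisson.exists_le_lintegral_iInf (hX : IsCompoundPoisson P lam e Z X)
    (hlam : 0 < lam) {s : ℝ} (hs : 0 < s) :
    ∃ b > 0, ∃ δ > 0, ∀ n : ℕ, 1 ≤ n → ∀ r : ℝ, ∀ C : Finset (StepPath (Fin d → ℝ)), C.Nonempty →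
      Real.log C.card ≤ r →
      ENNReal.ofReal ((δ / n * Real.exp (-(r / n))) ^ s * ((b / n) ^ (n + 1) / 2)) ≤
        ∫⁻ ω, (⨅ a ∈ C, pathDistortion (supDistortion d) (X ω) a ^ s) ∂P := by
  obtain ⟨κ, hκ, hκ'⟩ := hX.exists_half_le_norm
  set b := Real.exp (-(2 * lam)) * lam / 2 with hb
  have hb0 : 0 < b := by positivity
  -- With this `δ`, `4 lam ε / κ = (b / n) (b / (4 lam)) exp(-r/n)`. The powers of `exp(-r/n)`
  -- cancel the codebook size, and one factor `b / (4 lam)` turns `2 lam / n` into `(b / n) / 2`: at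
  -- most half of the event is lost.
  refine ⟨b, hb0, κ * b ^ 2 / (16 * lam ^ 2), by positivity, fun n hn r C hC hr => ?_⟩
  set δ := κ * b ^ 2 / (16 * lam ^ 2) with hδ
  have hn0 : (0 : ℝ) < n := by exact_mod_cast hn
  have hn1 : (1 : ℝ) ≤ n := by exact_mod_cast hn
  set ε := δ / n * Real.exp (-(r / n)) with hε
  have hε0 : 0 < ε := by positivity
  have hcard : (C.card : ℝ) ≤ Real.exp r := by
    have : (0 : ℝ) < C.card := by exact_mod_cast hC.card_pos
    rwa [← Real.log_le_iff_le_exp this]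
  refine le_trans ?_ (hX.le_lintegral_iInf hlam hκ hκ' hn hs.le hε0.le C)
  rw [ENNReal.ofReal_mul (by positivity), ENNReal.ofReal_rpow_of_pos hε0]
  refine mul_le_mul_right ?_ _
  have hα : (b / n) ^ (n + 1) ≤
      (Real.exp (-(2 * (lam / n))) * (lam / n)) ^ (n + 1) * 2⁻¹ ^ n := by
    calc (b / n) ^ (n + 1) = (Real.exp (-(2 * lam)) * (lam / n)) ^ (n + 1) * 2⁻¹ ^ (n + 1) := by
          rw [← mul_pow, hb]; congr 1; ring
      _ ≤ _ := by
          have h1 : lam / n ≤ lam := div_le_self hlam.le hn1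
          have h2 : (2 : ℝ)⁻¹ ^ (n + 1) ≤ 2⁻¹ ^ n :=
            pow_le_pow_of_le_one (by norm_num) (by norm_num) (Nat.le_succ n)
          gcongr
  have hβ : C.card * ((4 * lam * ε / κ) ^ n * (2 * (lam / n))) ≤ (b / n) ^ (n + 1) / 2 := by
    have hexp : Real.exp r * Real.exp (-(r / n)) ^ n = 1 := by
      rw [← Real.exp_nat_mul, ← Real.exp_add]
      have : r + n * -(r / n) = 0 := by field_simp; ring
      rw [this, Real.exp_zero]
    have hq1 : b / (4 * lam) ≤ 1 := by
      rw [hb, div_le_one (by positivity)]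
      have : Real.exp (-(2 * lam)) ≤ 1 := Real.exp_le_one_iff.2 (by linarith)
      nlinarith
    have hq : (b / (4 * lam)) ^ n ≤ b / (4 * lam) :=
      pow_le_of_le_one (by positivity) hq1 (by omega)
    calc C.card * ((4 * lam * ε / κ) ^ n * (2 * (lam / n)))
        ≤ Real.exp r * ((4 * lam * ε / κ) ^ n * (2 * (lam / n))) := by gcongr
      _ = Real.exp r * ((b / n * (b / (4 * lam)) * Real.exp (-(r / n))) ^ n * (2 * (lam / n))) := by
          have : 4 * lam * ε / κ = b / n * (b / (4 * lam)) * Real.exp (-(r / n)) := by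
            rw [hε, hδ]; field_simp; ring
          rw [this]
      _ = (Real.exp r * Real.exp (-(r / n)) ^ n) *
            ((b / n) ^ n * (b / (4 * lam)) ^ n * (2 * (lam / n))) := by
          rw [mul_pow, mul_pow]; ring
      _ ≤ 1 * ((b / n) ^ n * (b / (4 * lam)) * (2 * (lam / n))) := by rw [hexp]; gcongr
      _ = (b / n) ^ (n + 1) / 2 := by rw [pow_succ]; field_simp; norm_num
  have hE1 : (ENNReal.ofReal (Real.exp (-(2 * (lam / n)))) * ENNReal.ofReal (lam / n)) ^ (n + 1) *
      2⁻¹ ^ n = ENNReal.ofReal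
        ((Real.exp (-(2 * (lam / n))) * (lam / n)) ^ (n + 1) * 2⁻¹ ^ n) := by
    rw [ENNReal.ofReal_mul (by positivity), ENNReal.ofReal_pow (by positivity),
      ENNReal.ofReal_mul (by positivity), ENNReal.ofReal_pow (by positivity),
      ENNReal.ofReal_inv_of_pos two_pos, ENNReal.ofReal_ofNat]
  have hE2 : (C.card : ℝ≥0∞) * (ENNReal.ofReal (4 * lam * ε / κ) ^ n *
      ENNReal.ofReal (2 * (lam / n))) =
      ENNReal.ofReal (C.card * ((4 * lam * ε / κ) ^ n * (2 * (lam / n)))) := by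
    rw [ENNReal.ofReal_mul (p := (C.card : ℝ)) (by positivity), ENNReal.ofReal_natCast,
      ENNReal.ofReal_mul (p := (4 * lam * ε / κ) ^ n) (by positivity), ENNReal.ofReal_pow (by positivity)]
  rw [hE1, hE2, ← ENNReal.ofReal_sub _ (by positivity)]
  exact ENNReal.ofReal_le_ofReal (by linarith)

end LowerBound

/-! ### Choice of the number of jumps in the lower bound -/

/-- The normalization `√(2/s · r log r)`. -/
noncomputable def quantizationRate (s r : ℝ) : ℝ := Real.sqrt (2 / s * (r * Real.log r))

theorem tendsto_quantizationRate {s : ℝ} (hs : 0 < s) :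
    Tendsto (quantizationRate s) atTop atTop := by
  refine Real.tendsto_sqrt_atTop.comp (Tendsto.const_mul_atTop (by positivity) ?_)
  exact tendsto_id.atTop_mul_atTop₀ Real.tendsto_log_atTop

theorem eventually_log_le_quantizationRate {s : ℝ} (hs : 0 < s) {η : ℝ} (hη : 0 < η) :
    ∀ᶠ r in atTop, Real.log r ≤ η * quantizationRate s r := by
  have hc : 0 < η * Real.sqrt (2 / s) := by positivity
  have h := (isLittleO_log_rpow_atTop (by norm_num : (0 : ℝ) < 1 / 2)).bound hc
  filter_upwards [h, Real.tendsto_log_atTop.eventually_ge_atTop 1, eventually_gt_atTop 0]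
    with r hr hl hr0
  rw [Real.norm_of_nonneg (by linarith), Real.norm_of_nonneg (by positivity),
    ← Real.sqrt_eq_rpow] at hr
  refine hr.trans ?_
  rw [mul_assoc, ← Real.sqrt_mul (by positivity)]
  refine mul_le_mul_of_nonneg_left (Real.sqrt_le_sqrt ?_) hη.le
  have : r ≤ r * Real.log r := le_mul_of_one_le_right hr0.le hl
  gcongr

/-- The number of jumps which contributes most to the quantization error at rate `r`. -/
noncomputable def criticalJumps (s r : ℝ) : ℕ := ⌈Real.sqrt (2 * s * r / Real.log r)⌉₊

/-- The left side is minus the logarithm of the lower bound. Its main terms `s r / n` and `n log n`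
contribute `s g / 2` each, and everything else is `o(g)`. -/
theorem eventually_criticalJumps_bound {s : ℝ} (hs : 0 < s) (b δ : ℝ) {K : ℝ} (hK : 1 < K) :
    ∀ᶠ r in atTop, 1 ≤ criticalJumps s r ∧
      s * (r / criticalJumps s r + Real.log (criticalJumps s r) - Real.log δ) +
        ((criticalJumps s r + 1 : ℕ) * (Real.log (criticalJumps s r) - Real.log b) + Real.log 2)
        ≤ s * (K * quantizationRate s r) := by
  -- The errors form three groups, of order `log r`, `x |log b|` and a constant; each is at most `η
  -- s g`.
  set η := (K - 1) / 4 with hη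
  have hη0 : 0 < η := by rw [hη]; linarith
  have e1 := eventually_log_le_quantizationRate hs (η := η * s / (s + 1)) (by positivity)
  have e2 : ∀ᶠ r in atTop, |Real.log b| / η ≤ Real.log r :=
    Real.tendsto_log_atTop.eventually_ge_atTop _
  have e3 : ∀ᶠ r in atTop, (s * |Real.log δ| + 2 * |Real.log b| + Real.log 2) / (η * s) ≤
      quantizationRate s r := (tendsto_quantizationRate hs).eventually_ge_atTop _
  have e4 : ∀ᶠ r in atTop, 8 * s + 1 ≤ Real.log r := Real.tendsto_log_atTop.eventually_ge_atTop _
  filter_upwards [e1, e2, e3, e4, eventually_ge_atTop 4] with r h1 h2 h3 h4 h5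
  set L := Real.log r with hL
  set g := quantizationRate s r with hg
  set x := Real.sqrt (2 * s * r / L) with hx
  have hL0 : 0 < L := by linarith
  have hr0 : 0 < r := by linarith
  have hx0 : 0 < x := by positivity
  have hn1 : x ≤ criticalJumps s r := Nat.le_ceil _
  have hn2 : (criticalJumps s r : ℝ) < x + 1 := Nat.ceil_lt_add_one hx0.le
  set n := criticalJumps s r
  have hnpos : (0 : ℝ) < n := hx0.trans_le hn1
  have hnnat : 1 ≤ n := by exact_mod_cast hnpos
  have hn1' : (1 : ℝ) ≤ n := by exact_mod_cast hnnat
  refine ⟨hnnat, ?_⟩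
  have hg0 : 0 ≤ g := Real.sqrt_nonneg _
  have hg2 : g ^ 2 = 2 / s * (r * L) := Real.sq_sqrt (by positivity)
  have hx2 : x ^ 2 = 2 * s * r / L := Real.sq_sqrt (by positivity)
  have hxL : x * L = s * g := by
    refine (pow_left_inj₀ (by positivity) (by positivity) two_ne_zero).1 ?_
    rw [mul_pow, mul_pow, hg2, hx2]; field_simp
  have hrx : r / n ≤ g / 2 := by
    rw [div_le_iff₀ hnpos]
    have : r = g / 2 * x := by
      have h : x = s * g / L := by field_simp; exact hxL
      rw [h]
      have : g / 2 * (s * g / L) = s * g ^ 2 / (2 * L) := by ring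
      rw [this, hg2]; field_simp
    calc r = g / 2 * x := this
      _ ≤ g / 2 * n := by gcongr
  have hlogn : Real.log n ≤ L / 2 := by
    -- The largeness of `log r` makes `x ≤ √r / 2`, so rounding up still leaves `n ≤ √r`.
    have hsq : Real.sqrt r ≥ x + 1 := by
      have hx' : x ≤ Real.sqrt r / 2 := by
        rw [hx, show Real.sqrt r / 2 = Real.sqrt (r / 4) by
          rw [Real.sqrt_div hr0.le]; congr 1
          rw [show (4 : ℝ) = 2 ^ 2 by norm_num, Real.sqrt_sq two_pos.le]]
        refine Real.sqrt_le_sqrt ?_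
        rw [div_le_iff₀ hL0]
        nlinarith
      have h2 : 2 ≤ Real.sqrt r := Real.le_sqrt_of_sq_le (by linarith)
      linarith
    calc Real.log n ≤ Real.log (Real.sqrt r) := Real.log_le_log hnpos (by linarith)
      _ = L / 2 := Real.log_sqrt hr0.le
  have hlogn0 : 0 ≤ Real.log n := Real.log_nonneg hn1'
  have hb' : -Real.log b ≤ |Real.log b| := neg_le_abs _
  have hδ' : -Real.log δ ≤ |Real.log δ| := neg_le_abs _
  have hxb : x * |Real.log b| ≤ η * (s * g) := by
    rw [div_le_iff₀ hη0] at h2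
    calc x * |Real.log b| ≤ x * (L * η) := by gcongr
      _ = η * (x * L) := by ring
      _ = η * (s * g) := by rw [hxL]
  rw [div_le_iff₀ (by positivity)] at h3
  rw [div_mul_eq_mul_div, le_div_iff₀ (by positivity)] at h1
  have hmain : ((n + 1 : ℕ) : ℝ) * (Real.log n - Real.log b) ≤
      (x + 2) * (L / 2 + |Real.log b|) := by
    push_cast
    calc ((n : ℝ) + 1) * (Real.log n - Real.log b)
        ≤ (n + 1) * (L / 2 + |Real.log b|) := by gcongr; linarith
      _ ≤ (x + 2) * (L / 2 + |Real.log b|) := by gcongr ?_ * _; linarith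
  have hexpand : (x + 2) * (L / 2 + |Real.log b|) =
      s * g / 2 + L + x * |Real.log b| + 2 * |Real.log b| := by
    rw [← hxL]; ring
  have hKη : K = 1 + 4 * η := by rw [hη]; ring
  rw [hKη]
  have hs1 := mul_le_mul_of_nonneg_left hrx hs.le
  have hs2 := mul_le_mul_of_nonneg_left hlogn hs.le
  have hs3 := mul_le_mul_of_nonneg_left hδ' hs.le
  nlinarith [mul_nonneg hη0.le (mul_nonneg hs.le hg0)]

theorem le_quantizationError {Ω E : Type*} [MeasurableSpace Ω] {P : Measure Ω} {X : Ω → E}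
    {ρ : E → E → ℝ≥0∞} {s r : ℝ} {D : ℝ≥0∞} (hs : 0 < s)
    (h : ∀ C : Finset E, C.Nonempty → Real.log C.card ≤ r →
      D ^ s ≤ ∫⁻ ω, (⨅ a ∈ C, ρ (X ω) a ^ s) ∂P) :
    D ≤ quantizationError P X ρ s r := by
  refine le_iInf fun C => le_iInf fun hC => le_iInf fun hr => ?_
  rw [one_div, ENNReal.le_rpow_inv_iff hs]
  exact h C hC hr

theorem IsCompoundPoisson.eventually_le_quantizationError {Ω : Type*} [MeasurableSpace Ω]
    {P : Measure Ω} [IsProbabilityMeasure P] {d : ℕ} {lam : ℝ} {e : ℕ → Ω → ℝ}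
    {Z : ℕ → Ω → Fin d → ℝ} {X : Ω → StepPath (Fin d → ℝ)} (hX : IsCompoundPoisson P lam e Z X)
    (hlam : 0 < lam) {s : ℝ} (hs : 0 < s) {K : ℝ} (hK : 1 < K) :
    ∀ᶠ r in atTop, ENNReal.ofReal (Real.exp (-(K * quantizationRate s r))) ≤
      quantizationError P X (pathDistortion (supDistortion d)) s r := by
  obtain ⟨b, hb, δ, hδ, H⟩ := hX.exists_le_lintegral_iInf hlam hs
  filter_upwards [eventually_criticalJumps_bound hs b δ hK] with r ⟨hn, hr⟩
  refine le_quantizationError hs fun C hC hCr => le_trans ?_ (H _ hn r C hC hCr)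
  set n := criticalJumps s r
  have hn0 : (0 : ℝ) < n := by exact_mod_cast hn
  rw [ENNReal.ofReal_rpow_of_pos (Real.exp_pos _)]
  refine ENNReal.ofReal_le_ofReal ?_
  rw [← Real.log_le_log_iff (by positivity) (by positivity), Real.log_rpow (by positivity),
    Real.log_exp, Real.log_mul (by positivity) (by positivity), Real.log_rpow (by positivity),
    Real.log_mul (by positivity) (by positivity), Real.log_exp,
    Real.log_div (by positivity) two_ne_zero, Real.log_pow, Real.log_div hb.ne' hn0.ne',
    Real.log_div hδ.ne' hn0.ne']
  nlinarith

/-! ### Codebooks for the jump law and for paths with `n` jumps -/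

theorem eventually_exists_codebook {Ω E : Type*} [MeasurableSpace Ω] {P : Measure Ω} {Y : Ω → E}
    {ρ : E → E → ℝ≥0∞} {s : ℝ} (hs : 0 < s) (h0 : quantizationDimension P Y ρ s = 0) {η : ℝ}
    (hη : 0 < η) :
    ∀ᶠ y : ℝ in atTop, ∃ C : Finset E, C.Nonempty ∧ (C.card : ℝ) ≤ y ^ η ∧
      ∫⁻ ω, (⨅ a ∈ C, ρ (Y ω) a ^ s) ∂P ≤ ENNReal.ofReal (2 / y) ^ s := by
  have hlt : quantizationDimension P Y ρ s < (η : EReal) := by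
    rw [h0]; exact_mod_cast hη
  have hev := eventually_lt_of_limsup_lt hlt
  filter_upwards [tendsto_inv_atTop_nhdsGT_zero.eventually hev, eventually_gt_atTop 1] with y hy hy1
  have hy0 : 0 < y := by linarith
  have hlog : 0 < Real.log y := Real.log_pos hy1
  rw [one_div, inv_inv, EReal.div_lt_iff (by exact_mod_cast hlog) (EReal.coe_ne_top _),
    ← EReal.coe_mul, ← Real.log_rpow hy0, ← ENNReal.log_ofReal_of_pos (by positivity),
    ENNReal.log_lt_log_iff] at hy
  have htop : quantizationNumber P Y ρ s y⁻¹ ≠ ⊤ := by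
    intro h
    rw [h] at hy
    simp at hy
  obtain ⟨N, hN⟩ := ENat.ne_top_iff_exists.1 htop
  have hlt : quantizationNumber P Y ρ s y⁻¹ < ((N + 1 : ℕ) : ℕ∞) := by
    rw [← hN]; exact_mod_cast Nat.lt_succ_self N
  simp only [quantizationNumber, iInf_lt_iff] at hlt
  obtain ⟨n, hn1, hn, hnN⟩ := hlt
  have hnN' : n ≤ N := Nat.lt_succ_iff.1 (by exact_mod_cast hnN)
  have hNy : (N : ℝ) < y ^ η := by
    rw [← hN] at hy
    have hy' : ENNReal.ofReal (N : ℝ) < ENNReal.ofReal (y ^ η) := by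
      rw [ENNReal.ofReal_natCast]; exact_mod_cast hy
    exact (ENNReal.ofReal_lt_ofReal_iff (by positivity)).1 hy'
  -- The infimum over codebooks need not be attained; relaxing `1 / y` to `2 / y` makes the
  -- inequality strict and yields an actual codebook.
  have hlt2 : quantizationError P Y ρ s (Real.log n) < ENNReal.ofReal (2 / y) := by
    refine hn.trans_lt ((ENNReal.ofReal_lt_ofReal_iff (by positivity)).2 ?_)
    rw [inv_eq_one_div]
    gcongr
    norm_num
  simp only [quantizationError, iInf_lt_iff] at hlt2
  obtain ⟨C, hC, hCn, hCe⟩ := hlt2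
  refine ⟨C, hC, ?_, ?_⟩
  · have hc0 : (0 : ℝ) < C.card := by exact_mod_cast hC.card_pos
    have hn0 : (0 : ℝ) < n := by exact_mod_cast hn1
    have h1 : (C.card : ℝ) ≤ n := (Real.log_le_log_iff hc0 hn0).1 hCn
    have h2 : (n : ℝ) ≤ N := by exact_mod_cast hnN'
    linarith
  · rw [one_div] at hCe
    exact (ENNReal.rpow_inv_le_iff hs).1 hCe.le

/-- Each summand is at most the largest one. This crude bound works for every `s > 0`, and the power
of `n` it costs is negligible against `n log n`. -/
theorem sum_rpow_le {ι : Type*} (t : Finset ι) (w : ι → ℝ≥0∞) {s : ℝ} (hs : 0 < s) :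
    (∑ i ∈ t, w i) ^ s ≤ (t.card : ℝ≥0∞) ^ s * ∑ i ∈ t, w i ^ s := by
  rcases t.eq_empty_or_nonempty with rfl | ht
  · simp [hs]
  obtain ⟨k, hk, hmax⟩ := t.exists_max_image w ht
  calc (∑ i ∈ t, w i) ^ s ≤ (t.card * w k) ^ s := by
        refine ENNReal.rpow_le_rpow ?_ hs.le
        rw [← nsmul_eq_mul]
        exact Finset.sum_le_card_nsmul t w _ hmax
    _ = (t.card : ℝ≥0∞) ^ s * w k ^ s := ENNReal.mul_rpow_of_nonneg _ _ hs.le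
    _ ≤ _ := by
        gcongr
        exact Finset.single_le_sum (f := fun i => w i ^ s) (fun _ _ => zero_le) hk

theorem Finset.exists_le_iInf {ι α : Type*} [CompleteLinearOrder α] {C : Finset ι}
    (hC : C.Nonempty) (f : ι → α) : ∃ a ∈ C, f a ≤ ⨅ b ∈ C, f b := by
  obtain ⟨a, ha, hmin⟩ := C.exists_min_image f hC
  exact ⟨a, ha, le_iInf₂ hmin⟩

theorem iInf_rpow_eq {ι : Type*} {C : Finset ι} (hC : C.Nonempty) (f : ι → ℝ≥0∞) {s : ℝ}
    (hs : 0 ≤ s) : (⨅ a ∈ C, f a) ^ s = ⨅ a ∈ C, f a ^ s := by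
  refine le_antisymm (le_iInf₂ fun a ha => ENNReal.rpow_le_rpow (iInf₂_le a ha) hs) ?_
  obtain ⟨a, ha, hle⟩ := C.exists_le_iInf hC f
  exact (iInf₂_le a ha).trans (ENNReal.rpow_le_rpow hle hs)

/-- The path which jumps by `v i` at time `τ i`. -/
noncomputable def StepPath.ofJumps {V : Type*} [AddCommMonoid V] {n : ℕ} (τ : Fin n → ℝ)
    (v : Fin n → V) : StepPath V where
  toFun t := ∑ i, if τ i ≤ (t : ℝ) then v i else 0
  isStep := by
    refine ⟨Finset.univ.image τ, fun u w huw h => Finset.sum_congr rfl fun i _ => ?_⟩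
    have hi := h (τ i) (Finset.mem_image_of_mem _ (Finset.mem_univ i))
    by_cases h1 : τ i ≤ (u : ℝ)
    · have : τ i ≤ (w : ℝ) := h1.trans huw
      simp [h1, this]
    · have : ¬ τ i ≤ (w : ℝ) := fun h2 => hi ⟨not_le.1 h1, h2⟩
      simp [h1, this]

/-- Compare jump by jump. While only the approximation has jumped, the error is `‖v'‖ ≤ ‖v‖ + ‖v -
v'‖`; after both have jumped it is `‖v - v'‖`. -/
theorem pathDistortion_ofJumps_le {d n : ℕ} {τ τ' : Fin n → ℝ} {v v' : Fin n → Fin d → ℝ}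
    {f : StepPath (Fin d → ℝ)} (hf : ∀ t : Set.Ico (0 : ℝ) 1,
      f t = ∑ i, if τ i ≤ (t : ℝ) then v i else 0)
    (h0 : ∀ i, 0 ≤ τ' i) (hle : ∀ i, τ' i ≤ τ i) (h1 : ∀ i, τ i ≤ 1) :
    pathDistortion (supDistortion d) f (StepPath.ofJumps τ' v') ≤
      ∑ i, (ENNReal.ofReal ‖v i‖ * ENNReal.ofReal (τ i - τ' i) + supDistortion d (v i) (v' i)) := by
  have hm : ∀ i, MeasurableSet {t : Set.Ico (0 : ℝ) 1 | τ' i ≤ (t : ℝ) ∧ (t : ℝ) < τ i} := fun i =>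
    (measurableSet_le measurable_const measurable_subtype_coe).inter
      (measurableSet_lt measurable_subtype_coe measurable_const)
  have hpt : ∀ t : Set.Ico (0 : ℝ) 1, supDistortion d (f t) (StepPath.ofJumps τ' v' t) ≤
      ∑ i, ({t : Set.Ico (0 : ℝ) 1 | τ' i ≤ (t : ℝ) ∧ (t : ℝ) < τ i}.indicator
        (fun _ => ENNReal.ofReal ‖v i‖) t + supDistortion d (v i) (v' i)) := by
    intro t
    have hg : StepPath.ofJumps τ' v' t = ∑ i, if τ' i ≤ (t : ℝ) then v' i else 0 := rfl
    rw [supDistortion, hf t, hg, ← Finset.sum_sub_distrib]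
    refine (ENNReal.ofReal_le_ofReal (norm_sum_le _ _)).trans ?_
    rw [ENNReal.ofReal_sum_of_nonneg fun _ _ => norm_nonneg _]
    refine Finset.sum_le_sum fun i _ => ?_
    rw [supDistortion]
    by_cases ha : τ i ≤ (t : ℝ)
    · rw [if_pos ha, if_pos ((hle i).trans ha)]
      exact le_add_self
    · by_cases hb : τ' i ≤ (t : ℝ)
      · have hmem : t ∈ {t : Set.Ico (0 : ℝ) 1 | τ' i ≤ (t : ℝ) ∧ (t : ℝ) < τ i} :=
          ⟨hb, not_le.1 ha⟩
        rw [if_neg ha, if_pos hb, Set.indicator_of_mem hmem,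
          ← ENNReal.ofReal_add (norm_nonneg _) (norm_nonneg _)]
        refine ENNReal.ofReal_le_ofReal ?_
        rw [zero_sub, norm_neg]
        have := norm_sub_norm_le (v' i) (v i)
        rw [norm_sub_rev] at this
        linarith
      · rw [if_neg ha, if_neg hb]; simp
  refine (lintegral_mono hpt).trans ?_
  rw [lintegral_finsetSum _ fun i _ => (measurable_const.indicator (hm i)).add_const _]
  refine Finset.sum_le_sum fun i _ => ?_
  rw [lintegral_add_right _ measurable_const, lintegral_indicator_const (hm i),
    timeMeasure_Ico (h0 i) (h1 i), lintegral_const, measure_univ, mul_one]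

/-- A codebook `C` serves the paths with `n` jumps at the cost of at most `W` per jump. -/
def CoversJumps {d : ℕ} (C : Finset (StepPath (Fin d → ℝ))) (n : ℕ)
    (W : (Fin d → ℝ) → ℝ≥0∞) : Prop :=
  ∀ (f : StepPath (Fin d → ℝ)) (τ : Fin n → ℝ) (v : Fin n → Fin d → ℝ),
    (∀ i, τ i ∈ Set.Icc (0 : ℝ) 1) →
    (∀ t : Set.Ico (0 : ℝ) 1, f t = ∑ i, if τ i ≤ (t : ℝ) then v i else 0) →
    ∃ g ∈ C, pathDistortion (supDistortion d) f g ≤ ∑ i, W (v i)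

theorem CoversJumps.mono {d n : ℕ} {C C' : Finset (StepPath (Fin d → ℝ))}
    {W : (Fin d → ℝ) → ℝ≥0∞} (h : CoversJumps C n W) (hC : C ⊆ C') : CoversJumps C' n W :=
  fun f τ v hτ hf => let ⟨g, hg, hle⟩ := h f τ v hτ hf; ⟨g, hC hg, hle⟩

theorem coversJumps_zero {d n : ℕ} :
    CoversJumps {StepPath.ofJumps (fun _ : Fin 0 => (0 : ℝ)) fun _ => (0 : Fin d → ℝ)} n
      (fun v => ENNReal.ofReal ‖v‖) := by
  intro f τ v hτ hf
  refine ⟨_, Finset.mem_singleton_self _, ?_⟩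
  refine (lintegral_mono (g := fun _ => ∑ i, ENNReal.ofReal ‖v i‖) fun t => ?_).trans ?_
  · have hg : (StepPath.ofJumps (fun _ : Fin 0 => (0 : ℝ)) fun _ => (0 : Fin d → ℝ)) t = 0 := by
      simp [StepPath.ofJumps]
    rw [hg, hf t, supDistortion, sub_zero]
    refine (ENNReal.ofReal_le_ofReal (norm_sum_le _ _)).trans ?_
    rw [ENNReal.ofReal_sum_of_nonneg fun _ _ => norm_nonneg _]
    refine Finset.sum_le_sum fun i _ => ENNReal.ofReal_le_ofReal ?_
    split_ifs
    · exact le_rfl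
    · simp
  · rw [lintegral_const, measure_univ, mul_one]

/-- Round each jump time down to the grid of mesh `1 / K` and each jump to a nearest point of `Γ`.
The grid has `K + 1` points because time `1` is allowed. -/
theorem exists_coversJumps {d : ℕ} (n : ℕ) {K : ℕ} (hK : 1 ≤ K) {Γ : Finset (Fin d → ℝ)}
    (hΓ : Γ.Nonempty) :
    ∃ C : Finset (StepPath (Fin d → ℝ)), C.card ≤ ((K + 1) * Γ.card) ^ n ∧
      CoversJumps C n fun v => ENNReal.ofReal ‖v‖ * ENNReal.ofReal (1 / K) +
        ⨅ a ∈ Γ, supDistortion d v a := by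
  classical
  have hK0 : (0 : ℝ) < K := by exact_mod_cast hK
  refine ⟨Finset.univ.image fun c : Fin n → Fin (K + 1) × Γ =>
    StepPath.ofJumps (fun i => ((c i).1 : ℝ) / K) fun i => ((c i).2 : Fin d → ℝ), ?_, ?_⟩
  · refine Finset.card_image_le.trans (le_of_eq ?_)
    simp
  · intro f τ v hτ hf
    have hfl : ∀ i, ⌊K * τ i⌋₊ < K + 1 := fun i => by
      rw [Nat.lt_succ_iff]
      refine Nat.floor_le_of_le ?_
      exact mul_le_of_le_one_right hK0.le (hτ i).2
    have hnear : ∀ i, ∃ a : Γ, supDistortion d (v i) a ≤ ⨅ a ∈ Γ, supDistortion d (v i) a :=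
      fun i => let ⟨a, ha, hle⟩ := Γ.exists_le_iInf hΓ (supDistortion d (v i)); ⟨⟨a, ha⟩, hle⟩
    choose a ha using hnear
    have hle : ∀ i, (⌊K * τ i⌋₊ : ℝ) / K ≤ τ i := fun i => by
      rw [div_le_iff₀' hK0]
      exact Nat.floor_le (mul_nonneg hK0.le (hτ i).1)
    refine ⟨_, Finset.mem_image_of_mem _ (Finset.mem_univ fun i => (⟨⌊K * τ i⌋₊, hfl i⟩, a i)), ?_⟩
    refine (pathDistortion_ofJumps_le hf (fun i => by positivity) hle fun i => (hτ i).2).trans ?_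
    refine Finset.sum_le_sum fun i _ => add_le_add (mul_le_mul_right ?_ _) (ha i)
    refine ENNReal.ofReal_le_ofReal ?_
    rw [sub_le_iff_le_add, ← add_div, le_div_iff₀' hK0, add_comm]
    exact (Nat.lt_floor_add_one _).le

/-! ### Tail of the number of jumps and averaged error -/

section UpperBound

variable {Ω : Type*} [MeasurableSpace Ω] {P : Measure Ω} {d : ℕ}
  {lam : ℝ} {e : ℕ → Ω → ℝ} {Z : ℕ → Ω → Fin d → ℝ} {X : Ω → StepPath (Fin d → ℝ)}

theorem IsCompoundPoisson.measurable_sum_e (hX : IsCompoundPoisson P lam e Z X) (n : ℕ) :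
    Measurable fun ω => ∑ j ∈ Finset.range n, e j ω :=
  Finset.measurable_sum _ fun j _ => hX.measurable_e j

/-- Chernoff's bound with exponent `n`, giving the decay `exp(-n log n)` up to a factor exponential
in `n`. -/
theorem IsCompoundPoisson.measure_sum_e_le (hX : IsCompoundPoisson P lam e Z X) (n : ℕ) :
    P {ω | ∑ j ∈ Finset.range n, e j ω ≤ lam} ≤
      ENNReal.ofReal ((Real.exp lam / (n + 1)) ^ n) := by
  have hmeas : Measurable fun x : ℝ => ENNReal.ofReal (Real.exp (-(n * x))) := by fun_prop
  have hind : iIndepFun (fun j ω => ENNReal.ofReal (Real.exp (-(n * e j ω)))) P :=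
    hX.indep_e.comp (fun _ x => ENNReal.ofReal (Real.exp (-(n * x)))) fun _ => hmeas
  have hmS : MeasurableSet {ω | ∑ j ∈ Finset.range n, e j ω ≤ lam} :=
    measurableSet_le (hX.measurable_sum_e n) measurable_const
  calc P {ω | ∑ j ∈ Finset.range n, e j ω ≤ lam}
      = ∫⁻ ω, {ω | ∑ j ∈ Finset.range n, e j ω ≤ lam}.indicator 1 ω ∂P :=
        (lintegral_indicator_one hmS).symm
    _ ≤ ∫⁻ ω, ENNReal.ofReal (Real.exp (n * lam)) *
          ∏ j ∈ Finset.range n, ENNReal.ofReal (Real.exp (-(n * e j ω))) ∂P := by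
        refine lintegral_mono fun ω => Set.indicator_apply_le' (fun hω => ?_) fun _ => zero_le
        rw [← ENNReal.ofReal_prod_of_nonneg fun _ _ => (Real.exp_pos _).le, ← Real.exp_sum,
          ← ENNReal.ofReal_mul (Real.exp_pos _).le, ← Real.exp_add, Pi.one_apply,
          ENNReal.one_le_ofReal, Real.one_le_exp_iff, Finset.sum_neg_distrib, ← Finset.mul_sum]
        have : (n : ℝ) * ∑ j ∈ Finset.range n, e j ω ≤ n * lam :=
          mul_le_mul_of_nonneg_left hω (Nat.cast_nonneg n)
        linarith
    _ = ENNReal.ofReal (Real.exp (n * lam)) *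
          ∏ j ∈ Finset.range n, ∫⁻ ω, ENNReal.ofReal (Real.exp (-(n * e j ω))) ∂P := by
        have hm : ∀ j, Measurable fun ω => ENNReal.ofReal (Real.exp (-(n * e j ω))) :=
          fun j => hmeas.comp (hX.measurable_e j)
        rw [lintegral_const_mul _ (Finset.measurable_prod _ fun j _ => hm j),
          lintegral_prod_eq_prod_lintegral_of_indepFun _ _ hind hm]
    _ = ENNReal.ofReal (Real.exp (n * lam)) * ENNReal.ofReal (1 / (1 + n)) ^ n := by
        have : ∀ j, ∫⁻ ω, ENNReal.ofReal (Real.exp (-(n * e j ω))) ∂P =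
            ENNReal.ofReal (1 / (1 + n)) := fun j => by
          rw [← lintegral_exp_neg_mul_expMeasure (Nat.cast_nonneg n), ← hX.law_e j,
            lintegral_map hmeas (hX.measurable_e j)]
        simp [this]
    _ = _ := by
        rw [← ENNReal.ofReal_pow (by positivity), ← ENNReal.ofReal_mul (by positivity),
          Real.exp_nat_mul, ← mul_pow, mul_one_div, add_comm (1 : ℝ)]

theorem tendsto_div_succ_pow_zero (A : ℝ) :
    Tendsto (fun n : ℕ => (A / (n + 1)) ^ n) atTop (𝓝 0) := by
  have h : Tendsto (fun n : ℕ => |A| / ((n : ℝ) + 1)) atTop (𝓝 0) :=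
    tendsto_const_nhds.div_atTop
      (tendsto_atTop_add_const_right _ _ tendsto_natCast_atTop_atTop)
  have hgeo := tendsto_pow_atTop_nhds_zero_of_lt_one (r := (1 / 2 : ℝ)) (by norm_num) (by norm_num)
  refine squeeze_zero_norm' ?_ hgeo
  filter_upwards [h.eventually_le_const (by norm_num : (0 : ℝ) < 1 / 2)] with n hn
  rw [norm_pow, norm_div, Real.norm_eq_abs, Real.norm_of_nonneg (by positivity : (0 : ℝ) ≤ n + 1)]
  gcongr

theorem IsCompoundPoisson.ae_exists_lt_sum_e (hX : IsCompoundPoisson P lam e Z X) :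
    ∀ᵐ ω ∂P, ∃ m, lam < ∑ j ∈ Finset.range m, e j ω := by
  rw [ae_iff]
  have hlim : Tendsto (fun n : ℕ => ENNReal.ofReal ((Real.exp lam / (n + 1)) ^ n)) atTop (𝓝 0) := by
    simpa using ENNReal.tendsto_ofReal (tendsto_div_succ_pow_zero (Real.exp lam))
  refine le_antisymm (ge_of_tendsto' hlim fun n => ?_) zero_le
  refine le_trans (measure_mono fun ω hω => ?_) (hX.measure_sum_e_le n)
  exact not_lt.1 fun h => hω ⟨n, h⟩

/-- Almost surely some `n` satisfies `S_n ≤ lam < S_(n+1)`, and the path then has `n` candidate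
jumps in `[0, 1]`. Keeping only `S_n ≤ lam` and summing over `n` gives an upper bound in which
independence separates times from jumps. -/
theorem IsCompoundPoisson.lintegral_iInf_le_tsum (hX : IsCompoundPoisson P lam e Z X)
    (hlam : 0 < lam) {s : ℝ} (hs : 0 < s) {C : Finset (StepPath (Fin d → ℝ))}
    {W : ℕ → (Fin d → ℝ) → ℝ≥0∞} (hW : ∀ n, Measurable (W n)) (hC : ∀ n, CoversJumps C n (W n)) :
    ∫⁻ ω, (⨅ a ∈ C, pathDistortion (supDistortion d) (X ω) a ^ s) ∂P ≤
      ∑' n : ℕ, P {ω | ∑ j ∈ Finset.range n, e j ω ≤ lam} *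
        ((n : ℝ≥0∞) ^ s * (n * ∫⁻ ω, W n (Z 0 ω) ^ s ∂P)) := by
  set S : ℕ → Set (ℕ → ℝ) := fun n => {x | ∑ j ∈ Finset.range n, x j ≤ lam} with hS
  have hSm : ∀ n, MeasurableSet (S n) := fun n =>
    measurableSet_le (Finset.measurable_sum _ fun j _ => measurable_pi_apply j) measurable_const
  have he : Measurable fun ω j => e j ω := measurable_pi_lambda _ hX.measurable_e
  set F : ℕ → (ℕ → Fin d → ℝ) → ℝ≥0∞ := fun n z =>
    (n : ℝ≥0∞) ^ s * ∑ i ∈ Finset.range n, W n (z i) ^ s with hF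
  have hFm : ∀ n, Measurable (F n) := fun n =>
    (Finset.measurable_sum _ fun i _ =>
      ((hW n).comp (measurable_pi_apply i)).pow_const s).const_mul _
  have h1m : ∀ n, Measurable ((S n).indicator (1 : (ℕ → ℝ) → ℝ≥0∞)) := fun n =>
    measurable_one.indicator (hSm n)
  have hpt : ∀ᵐ ω ∂P, (⨅ a ∈ C, pathDistortion (supDistortion d) (X ω) a ^ s) ≤
      ∑' n, (S n).indicator 1 (fun j => e j ω) * F n fun i => Z i ω := by
    filter_upwards [hX.ae_nonneg, hX.X_eq, hX.ae_exists_lt_sum_e] with ω he0 hXω hex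
    have hfind := Nat.find_spec hex
    have hpos : Nat.find hex ≠ 0 := fun h => by
      rw [h] at hfind
      simp only [Finset.range_zero, Finset.sum_empty] at hfind
      exact absurd hfind (not_lt.2 hlam.le)
    obtain ⟨n, hn⟩ := Nat.exists_eq_succ_of_ne_zero hpos
    have hle : ∑ j ∈ Finset.range n, e j ω ≤ lam := not_lt.1 (Nat.find_min hex (by omega))
    rw [hn] at hfind
    refine le_trans ?_ (ENNReal.le_tsum n)
    have hmem : (fun j => e j ω) ∈ S n := hle
    rw [Set.indicator_of_mem hmem, Pi.one_apply, one_mul]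
    obtain ⟨g, hg, hgle⟩ := hC n (X ω) (fun i : Fin n => (∑ j ∈ Finset.range (i + 1), e j ω) / lam)
      (fun i => Z i ω)
      (fun i => ⟨div_nonneg (Finset.sum_nonneg fun j _ => he0 j) hlam.le,
        (div_le_one hlam).2 ((monotone_sum_range_of_nonneg he0 i.2).trans hle)⟩)
      (fun t => by
        have hlt : lam * (t : ℝ) < ∑ j ∈ Finset.range (n + 1), e j ω :=
          (mul_le_of_le_one_right hlam.le t.2.2.le).trans_lt hfind
        rw [hXω t, sum_range_countingFunction he0 hlt (mul_nonneg hlam.le t.2.1),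
          ← Fin.sum_univ_eq_sum_range
            (fun i => if ∑ j ∈ Finset.range (i + 1), e j ω ≤ lam * t then Z i ω else 0) n]
        refine Finset.sum_congr rfl fun i _ => ?_
        simp only [div_le_iff₀' hlam])
    refine (iInf₂_le g hg).trans ((ENNReal.rpow_le_rpow hgle hs.le).trans ?_)
    refine (sum_rpow_le _ _ hs).trans ?_
    rw [Finset.card_fin, Fin.sum_univ_eq_sum_range (fun i => W n (Z i ω) ^ s) n]
  refine (lintegral_mono_ae hpt).trans ?_
  have h1e : ∀ n, Measurable fun ω => (S n).indicator (1 : (ℕ → ℝ) → ℝ≥0∞) fun j => e j ω :=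
    fun n => (h1m n).comp he
  have hFZ : ∀ n, Measurable fun ω => F n fun i => Z i ω := fun n =>
    (hFm n).comp hX.measurable_Z_seq
  rw [lintegral_tsum fun n => ((h1e n).fun_mul (hFZ n)).aemeasurable]
  refine ENNReal.tsum_le_tsum fun n => le_of_eq ?_
  have hind : IndepFun (fun ω => (S n).indicator (1 : (ℕ → ℝ) → ℝ≥0∞) fun j => e j ω)
      (fun ω => F n fun i => Z i ω) P := hX.indep_e_Z.comp (h1m n) (hFm n)
  rw [lintegral_mul_eq_lintegral_mul_lintegral_of_indepFun'' (h1e n).aemeasurable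
    (hFZ n).aemeasurable hind]
  congr 1
  · have hmS : MeasurableSet {ω | ∑ j ∈ Finset.range n, e j ω ≤ lam} :=
      measurableSet_le (hX.measurable_sum_e n) measurable_const
    rw [← lintegral_indicator_one hmS]
    rfl
  · rw [hF]
    have hWZ : ∀ i, Measurable fun ω => W n (Z i ω) ^ s := fun i =>
      ((hW n).comp (hX.measurable_Z i)).pow_const s
    rw [lintegral_const_mul _ (Finset.measurable_sum _ fun i _ => hWZ i),
      lintegral_finsetSum _ fun i _ => hWZ i]
    congr 1
    have hident : ∀ i, ∫⁻ ω, W n (Z i ω) ^ s ∂P = ∫⁻ ω, W n (Z 0 ω) ^ s ∂P := fun i =>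
      ((hX.identDistrib_Z i).comp ((hW n).pow_const s)).lintegral_eq
    simp [hident]

theorem measurable_supDistortion_right (a : Fin d → ℝ) : Measurable fun v => supDistortion d v a :=
  ENNReal.measurable_ofReal.comp (measurable_norm.comp (measurable_id.sub_const a))

theorem measurable_iInf_supDistortion (Γ : Finset (Fin d → ℝ)) :
    Measurable fun v => ⨅ a ∈ Γ, supDistortion d v a :=
  Measurable.biInf (Γ : Set (Fin d → ℝ)) Γ.countable_toSet fun a _ =>
    measurable_supDistortion_right a

/-- Dimension zero provides a finite codebook with finite error, and a finite codebook is bounded.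
-/
theorem lintegral_norm_rpow_lt_top [IsProbabilityMeasure P] {Y : Ω → Fin d → ℝ} {s : ℝ}
    (hs : 0 < s) (h0 : quantizationDimension P Y (supDistortion d) s = 0) :
    ∫⁻ ω, ENNReal.ofReal ‖Y ω‖ ^ s ∂P < ∞ := by
  obtain ⟨y, Γ, hΓ, -, hy⟩ := (eventually_exists_codebook hs h0 one_pos).exists
  set R : ℝ := ∑ a ∈ Γ, ‖a‖ with hR
  have hpt : ∀ ω, ENNReal.ofReal ‖Y ω‖ ^ s ≤
      (2 : ℝ≥0∞) ^ s * ((⨅ a ∈ Γ, supDistortion d (Y ω) a ^ s) + ENNReal.ofReal R ^ s) := by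
    intro ω
    obtain ⟨a, ha, hle⟩ := Γ.exists_le_iInf hΓ (supDistortion d (Y ω))
    have h1 : ENNReal.ofReal ‖Y ω‖ ≤ (⨅ a ∈ Γ, supDistortion d (Y ω) a) + ENNReal.ofReal R := by
      refine le_trans ?_ (add_le_add_left hle _)
      rw [supDistortion, ← ENNReal.ofReal_add (norm_nonneg _)
        (Finset.sum_nonneg fun _ _ => norm_nonneg _)]
      refine ENNReal.ofReal_le_ofReal ?_
      have h2 := norm_sub_norm_le (Y ω) a
      have h3 : ‖a‖ ≤ R := Finset.single_le_sum (f := fun a => ‖a‖) (fun _ _ => norm_nonneg _) ha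
      linarith
    refine (ENNReal.rpow_le_rpow h1 hs.le).trans ?_
    have := sum_rpow_le (Finset.univ : Finset (Fin 2))
      ![⨅ a ∈ Γ, supDistortion d (Y ω) a, ENNReal.ofReal R] hs
    simpa [iInf_rpow_eq hΓ _ hs.le] using this
  refine (lintegral_mono hpt).trans_lt ?_
  rw [lintegral_const_mul' _ _ (ENNReal.rpow_ne_top_of_nonneg hs.le ENNReal.ofNat_ne_top),
    lintegral_add_right _ measurable_const, lintegral_const, measure_univ, mul_one]
  refine ENNReal.mul_lt_top (ENNReal.rpow_lt_top_of_nonneg hs.le ENNReal.ofNat_ne_top)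
    (ENNReal.add_lt_top.2 ⟨hy.trans_lt ?_, ?_⟩)
  · exact ENNReal.rpow_lt_top_of_nonneg hs.le ENNReal.ofReal_ne_top
  · exact ENNReal.rpow_lt_top_of_nonneg hs.le ENNReal.ofReal_ne_top

/-- Half of `η` pays for the jump codebook, the other half for the constant in `K + 1 ≤ 2 y`. The
threshold on `y` is uniform in `n`, as needed when `y` depends on `n`. -/
theorem eventually_exists_coversJumps {Y : Ω → Fin d → ℝ}
    (hY : Measurable Y) {s : ℝ} (hs : 0 < s)
    (h0 : quantizationDimension P Y (supDistortion d) s = 0) {η : ℝ} (hη : 0 < η) :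
    ∀ᶠ y : ℝ in atTop, ∀ n : ℕ, ∃ C : Finset (StepPath (Fin d → ℝ)), ∃ W, Measurable W ∧
      (C.card : ℝ) ≤ (y ^ (1 + η)) ^ n ∧ CoversJumps C n W ∧
      ∫⁻ ω, W (Y ω) ^ s ∂P ≤ ENNReal.ofReal (4 / y) ^ s *
        (∫⁻ ω, ENNReal.ofReal ‖Y ω‖ ^ s ∂P + 1) := by
  filter_upwards [eventually_exists_codebook hs h0 (half_pos hη), eventually_ge_atTop 1,
    (tendsto_rpow_atTop (half_pos hη)).eventually_ge_atTop 2] with y ⟨Γ, hΓ, hΓc, hΓe⟩ hy1 hy2 n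
  have hy0 : 0 < y := by linarith
  set K := ⌊y⌋₊ with hK
  have hK1 : 1 ≤ K := Nat.one_le_floor_iff y |>.2 hy1
  have hKle : (K : ℝ) ≤ y := Nat.floor_le hy0.le
  have hKlt : y < K + 1 := Nat.lt_floor_add_one y
  have hK1' : (1 : ℝ) ≤ K := by exact_mod_cast hK1
  obtain ⟨C, hC, hcov⟩ := exists_coversJumps n hK1 hΓ
  refine ⟨C, _, ?_, ?_, hcov, ?_⟩
  · exact ((ENNReal.measurable_ofReal.comp measurable_norm).mul_const _).add
      (measurable_iInf_supDistortion Γ)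
  · calc (C.card : ℝ) ≤ (((K + 1) * Γ.card) ^ n : ℕ) := by exact_mod_cast hC
      _ = (((K : ℝ) + 1) * Γ.card) ^ n := by push_cast; ring
      _ ≤ (y ^ (1 + η)) ^ n := by
          gcongr
          calc ((K : ℝ) + 1) * Γ.card ≤ (y * 2) * y ^ (η / 2) := by
                gcongr
                linarith
            _ ≤ (y * y ^ (η / 2)) * y ^ (η / 2) := by gcongr
            _ = y ^ (1 + η) := by
                rw [mul_assoc, ← Real.rpow_add hy0, add_halves, Real.rpow_add hy0, Real.rpow_one]
  · have hKinv : ENNReal.ofReal (1 / K) ≤ ENNReal.ofReal (2 / y) := by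
      refine ENNReal.ofReal_le_ofReal ?_
      rw [div_le_div_iff₀ (by linarith) hy0]
      linarith
    have hpt : ∀ ω, (ENNReal.ofReal ‖Y ω‖ * ENNReal.ofReal (1 / K) +
        ⨅ a ∈ Γ, supDistortion d (Y ω) a) ^ s ≤
        (2 : ℝ≥0∞) ^ s * (ENNReal.ofReal ‖Y ω‖ ^ s * ENNReal.ofReal (2 / y) ^ s +
          ⨅ a ∈ Γ, supDistortion d (Y ω) a ^ s) := by
      intro ω
      have := sum_rpow_le (Finset.univ : Finset (Fin 2))
        ![ENNReal.ofReal ‖Y ω‖ * ENNReal.ofReal (1 / K), ⨅ a ∈ Γ, supDistortion d (Y ω) a] hs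
      simp only [Fin.sum_univ_two, Matrix.cons_val_zero, Matrix.cons_val_one, Finset.card_univ,
        Fintype.card_fin, Nat.cast_ofNat, iInf_rpow_eq hΓ _ hs.le,
        ENNReal.mul_rpow_of_nonneg _ _ hs.le] at this
      refine this.trans ?_
      gcongr
    refine (lintegral_mono hpt).trans ?_
    have hm : Measurable fun ω => ENNReal.ofReal ‖Y ω‖ ^ s :=
      (ENNReal.measurable_ofReal.comp (measurable_norm.comp hY)).pow_const s
    rw [lintegral_const_mul' _ _ (ENNReal.rpow_ne_top_of_nonneg hs.le ENNReal.ofNat_ne_top),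
      lintegral_add_left (hm.mul_const _), lintegral_mul_const _ hm]
    have h4 : ENNReal.ofReal (4 / y) ^ s = (2 : ℝ≥0∞) ^ s * ENNReal.ofReal (2 / y) ^ s := by
      rw [← ENNReal.mul_rpow_of_nonneg _ _ hs.le, ← ENNReal.ofReal_ofNat 2,
        ← ENNReal.ofReal_mul (by norm_num)]
      congr 2
      ring
    rw [h4, mul_assoc]
    refine mul_le_mul_right ?_ _
    rw [mul_add, mul_one, mul_comm]
    exact add_le_add_right hΓe _

end UpperBound

/-! ### Estimates uniform in the number of jumps -/

/-- A fraction `1 - t` of `n log n` absorbs the geometric and polynomial factors up to a constant.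
-/
theorem exists_log_jump_weight_le {s A t : ℝ} (hs : 0 < s) (ht : t < 1) :
    ∃ c, ∀ n : ℕ, 1 ≤ n →
      n * (Real.log A - Real.log (n + 1)) + (s + 1) * Real.log n ≤ c - t * (n * Real.log n) := by
  set b := |Real.log A| + s + 1 with hb
  have hb0 : 0 < b := by positivity
  have ht' : 0 < 1 - t := by linarith
  refine ⟨Real.exp (b / (1 - t)) * b, fun n hn => ?_⟩
  have hn1 : (1 : ℝ) ≤ n := by exact_mod_cast hn
  have hn0 : (0 : ℝ) < n := by linarith
  have h1 : Real.log n ≤ Real.log (n + 1) := Real.log_le_log hn0 (by linarith)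
  have h2 : Real.log n ≤ n := (Real.log_le_sub_one_of_pos hn0).trans (by linarith)
  have hA : Real.log A ≤ |Real.log A| := le_abs_self _
  have hbound : n * (Real.log A - Real.log (n + 1)) + (s + 1) * Real.log n + t * (n * Real.log n)
      ≤ n * (b - (1 - t) * Real.log n) := by
    have e1 : n * (Real.log A - Real.log (n + 1)) ≤ n * (|Real.log A| - Real.log n) := by
      gcongr
    have e2 : (s + 1) * Real.log n ≤ (s + 1) * n := by gcongr
    rw [hb]
    linarith
  have hl0 : 0 ≤ Real.log n := Real.log_nonneg hn1
  suffices n * (b - (1 - t) * Real.log n) ≤ Real.exp (b / (1 - t)) * b by linarith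
  rcases le_total (b / (1 - t)) (Real.log n) with h | h
  · rw [div_le_iff₀ ht'] at h
    have : n * (b - (1 - t) * Real.log n) ≤ 0 :=
      mul_nonpos_of_nonneg_of_nonpos hn0.le (by linarith)
    exact this.trans (by positivity)
  · rw [Real.log_le_iff_le_exp hn0] at h
    calc n * (b - (1 - t) * Real.log n) ≤ n * b := by
          gcongr
          exact sub_le_self _ (by positivity)
      _ ≤ _ := by gcongr

/-- Three ranges: for `n ≤ r^(t/2)` the term `s r / n` suffices alone; up to `⌈√r⌉` one has `log n ≥
(t/2) log r` and AM-GM applies; beyond, `n log n` is at least `√r (log r) / 2`, which dominates `√(r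
log r)`. -/
theorem eventually_jump_exponent_le {s t : ℝ} (hs : 0 < s) (ht0 : 0 < t) (ht1 : t < 1) :
    ∀ᶠ r in atTop, ∀ n : ℕ, 1 ≤ n →
      t ^ 2 * (s * quantizationRate s r) ≤
        t * (n * Real.log n) + if n ≤ ⌈Real.sqrt r⌉₊ then t * s * r / n else 0 := by
  have ht' : 0 < 1 - t := by linarith
  have e1 := (isLittleO_log_rpow_atTop ht').bound (show 0 < s / 2 by positivity)
  filter_upwards [e1, Real.tendsto_log_atTop.eventually_ge_atTop (8 * s + 1),
    eventually_gt_atTop 1] with r h1 h2 hr1 n hn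
  set L := Real.log r with hL
  set g := quantizationRate s r with hg
  have hr0 : 0 < r := by linarith
  have hL0 : 0 < L := by linarith
  have hn1 : (1 : ℝ) ≤ n := by exact_mod_cast hn
  have hn0 : (0 : ℝ) < n := by linarith
  have hl0 : 0 ≤ Real.log n := Real.log_nonneg hn1
  have hg0 : 0 ≤ g := Real.sqrt_nonneg _
  have hg2 : g ^ 2 = 2 / s * (r * L) := Real.sq_sqrt (by positivity)
  have hsg : (s * g) ^ 2 = 2 * s * r * L := by rw [mul_pow, hg2]; field_simp
  have hsg0 : 0 ≤ s * g := by positivity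
  rw [Real.norm_of_nonneg hL0.le, Real.norm_of_nonneg (by positivity)] at h1
  split_ifs with hM
  · rcases le_total (t / 2 * L) (Real.log n) with hcase | hcase
    · have hab : t * (s * g) ≤ n * (t / 2 * L) + s * r / n := by
        refine le_of_abs_le (abs_le_of_sq_le_sq ?_ (by positivity))
        have h4 : 4 * ((n * (t / 2 * L)) * (s * r / n)) = t * (s * g) ^ 2 := by
          rw [hsg]; field_simp; ring
        have h5 : (t * (s * g)) ^ 2 ≤ t * (s * g) ^ 2 := by
          rw [mul_pow]
          gcongr
          nlinarith
        nlinarith [sq_nonneg (n * (t / 2 * L) - s * r / n)]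
      have h6 : n * (t / 2 * L) ≤ n * Real.log n := by gcongr
      calc t ^ 2 * (s * g) = t * (t * (s * g)) := by ring
        _ ≤ t * (n * Real.log n + s * r / n) := by gcongr; linarith
        _ = _ := by ring
    · have hnle : (n : ℝ) ≤ r ^ (t / 2) := by
        rw [← Real.log_le_log_iff hn0 (by positivity), Real.log_rpow hr0]
        exact hcase
      have hgle : g ≤ r ^ (1 - t / 2) := by
        refine Real.sqrt_le_iff.2 ⟨by positivity, ?_⟩
        rw [← Real.rpow_natCast, ← Real.rpow_mul hr0.le]
        have : (1 - t / 2) * ((2 : ℕ) : ℝ) = 1 + (1 - t) := by push_cast; ring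
        rw [this, Real.rpow_add hr0, Real.rpow_one]
        calc 2 / s * (r * L) ≤ 2 / s * (r * (s / 2 * r ^ (1 - t))) := by gcongr
          _ = r * r ^ (1 - t) := by field_simp
      have hrn : r ^ (1 - t / 2) ≤ r / n := by
        rw [le_div_iff₀ hn0]
        calc r ^ (1 - t / 2) * n ≤ r ^ (1 - t / 2) * r ^ (t / 2) := by gcongr
          _ = r := by rw [← Real.rpow_add hr0]; simp
      calc t ^ 2 * (s * g) ≤ t * (s * (r / n)) := by
            gcongr
            · nlinarith
            · exact hgle.trans hrn
        _ = t * s * r / n := by ring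
        _ ≤ _ := le_add_of_nonneg_left (by positivity)
  · have hsq : Real.sqrt r ≤ n := (Nat.le_ceil _).trans (by exact_mod_cast (not_le.1 hM).le)
    have hln : L / 2 ≤ Real.log n := by
      rw [hL, ← Real.log_sqrt hr0.le]
      exact Real.log_le_log (by positivity) hsq
    have hkey : s * g ≤ Real.sqrt r * (L / 2) := by
      refine le_of_abs_le (abs_le_of_sq_le_sq ?_ (by positivity))
      rw [hsg, mul_pow, Real.sq_sqrt hr0.le]
      have : 0 ≤ r * L * (L - 8 * s) := mul_nonneg (by positivity) (by linarith)
      nlinarith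
    calc t ^ 2 * (s * g) ≤ t * (Real.sqrt r * (L / 2)) := by
          gcongr
          nlinarith
      _ ≤ t * (n * Real.log n) := by gcongr
      _ = _ := (add_zero _).symm

theorem eventually_jump_term_le {s A c t K : ℝ} (hs : 0 < s) (hA : 0 < A) (hc : 0 < c)
    (ht0 : 0 < t) (ht1 : t < 1) (hK : K < t ^ 2) :
    ∀ᶠ r in atTop, ∀ n : ℕ, 1 ≤ n →
      c * ((A / (n + 1)) ^ n * (n : ℝ) ^ (s + 1) *
        if n ≤ ⌈Real.sqrt r⌉₊ then Real.exp (-(t * s * r / n)) else 1) ≤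
      Real.exp (-(s * (K * quantizationRate s r))) := by
  obtain ⟨c', hc'⟩ := exists_log_jump_weight_le (A := A) hs ht1
  filter_upwards [eventually_jump_exponent_le hs ht0 ht1,
    (tendsto_quantizationRate hs).eventually_ge_atTop ((c' + Real.log c) / ((t ^ 2 - K) * s))]
    with r h1 h2 n hn
  have hn0 : (0 : ℝ) < n := by exact_mod_cast hn
  rw [div_le_iff₀ (mul_pos (by linarith) hs)] at h2
  have hif : (if n ≤ ⌈Real.sqrt r⌉₊ then Real.exp (-(t * s * r / n)) else 1) =
      Real.exp (-(if n ≤ ⌈Real.sqrt r⌉₊ then t * s * r / n else 0)) := by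
    split_ifs <;> simp
  rw [hif, ← Real.log_le_log_iff (by positivity) (by positivity), Real.log_exp,
    Real.log_mul (by positivity) (by positivity), Real.log_mul (by positivity) (by positivity),
    Real.log_mul (by positivity) (by positivity), Real.log_exp, Real.log_pow,
    Real.log_div (by positivity) (by positivity), Real.log_rpow hn0]
  have h3 := hc' n hn
  have h4 := h1 n hn
  linarith

theorem eventually_self_le_exp {a : ℝ} (ha : 0 < a) : ∀ᶠ r in atTop, r ≤ Real.exp (a * r) := by
  filter_upwards [eventually_ge_atTop (4 / a ^ 2), eventually_gt_atTop 0] with r hr hr0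
  have h1 : a * r / 2 ≤ Real.exp (a * r / 2) := by
    have := Real.add_one_le_exp (a * r / 2); linarith
  rw [div_le_iff₀ (by positivity)] at hr
  have h2 : Real.exp (a * r) = Real.exp (a * r / 2) ^ 2 := by
    rw [← Real.exp_nat_mul]; congr 1; push_cast; ring
  rw [h2]
  calc r ≤ (a * r / 2) ^ 2 := by nlinarith
    _ ≤ _ := by gcongr

/-! ### One codebook for all jump counts -/

section UpperBound

variable {Ω : Type*} [MeasurableSpace Ω] {P : Measure Ω} {d : ℕ}
  {lam : ℝ} {e : ℕ → Ω → ℝ} {Z : ℕ → Ω → Fin d → ℝ} {X : Ω → StepPath (Fin d → ℝ)}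

theorem eventually_exists_common_codebook {Y : Ω → Fin d → ℝ} (hY : Measurable Y) {s : ℝ}
    (hs : 0 < s) (h0 : quantizationDimension P Y (supDistortion d) s = 0) {t : ℝ} (ht0 : 0 < t)
    (ht1 : t < 1) :
    ∀ᶠ r in atTop, ∃ (C : Finset (StepPath (Fin d → ℝ))) (W : ℕ → (Fin d → ℝ) → ℝ≥0∞),
      C.Nonempty ∧ Real.log C.card ≤ r ∧ (∀ n, Measurable (W n)) ∧ (∀ n, CoversJumps C n (W n)) ∧
      ∀ n : ℕ, 1 ≤ n → ∫⁻ ω, W n (Y ω) ^ s ∂P ≤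
        ENNReal.ofReal (4 ^ s * if n ≤ ⌈Real.sqrt r⌉₊ then Real.exp (-(t * s * r / n)) else 1) *
        (∫⁻ ω, ENNReal.ofReal ‖Y ω‖ ^ s ∂P + 1) := by
  classical
  -- Then each codebook uses rate `t (1 + η) r = (1 + t) r / 2`, leaving `(1 - t) r / 2` to pay for
  -- the union.
  set η := (1 / t - 1) / 2 with hη
  have htη : t * (1 + η) = (1 + t) / 2 := by rw [hη]; field_simp; ring
  have hη0 : 0 < η := by
    have : 1 < 1 / t := by rw [lt_div_iff₀ ht0]; linarith
    rw [hη]; linarith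
  obtain ⟨y₀, hy₀⟩ := eventually_atTop.1 (eventually_exists_coversJumps hY hs h0 hη0)
  -- For `n ≤ M ≤ 2 √r` this is a lower bound for `y = exp(t r / n)`, so one threshold on `r` serves
  -- all these `n`.
  have hlim : Tendsto (fun r => Real.exp (t / 2 * Real.sqrt r)) atTop atTop :=
    Real.tendsto_exp_atTop.comp (Real.tendsto_sqrt_atTop.const_mul_atTop (by positivity))
  filter_upwards [hlim.eventually_ge_atTop y₀, eventually_ge_atTop 9,
    eventually_self_le_exp (show 0 < (1 - t) / 2 by linarith)] with r hr hr9 hrexp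
  have hr0 : 0 < r := by linarith
  set M := ⌈Real.sqrt r⌉₊ with hM
  have hsq3 : 3 ≤ Real.sqrt r := Real.le_sqrt_of_sq_le (by linarith)
  have hsqsq : Real.sqrt r ^ 2 = r := Real.sq_sqrt hr0.le
  have hMlt : (M : ℝ) < Real.sqrt r + 1 := Nat.ceil_lt_add_one (Real.sqrt_nonneg r)
  set C₀ : Finset (StepPath (Fin d → ℝ)) :=
    {StepPath.ofJumps (fun _ : Fin 0 => (0 : ℝ)) fun _ => (0 : Fin d → ℝ)} with hC₀
  have hex : ∀ n : ℕ, ∃ (C : Finset (StepPath (Fin d → ℝ))) (W : (Fin d → ℝ) → ℝ≥0∞),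
      Measurable W ∧ (C.card : ℝ) ≤ Real.exp ((1 + t) / 2 * r) ∧ CoversJumps C n W ∧
      (M < n → C = C₀) ∧ (1 ≤ n → ∫⁻ ω, W (Y ω) ^ s ∂P ≤
        ENNReal.ofReal (4 ^ s * if n ≤ M then Real.exp (-(t * s * r / n)) else 1) *
        (∫⁻ ω, ENNReal.ofReal ‖Y ω‖ ^ s ∂P + 1)) := by
    intro n
    by_cases hn : 1 ≤ n ∧ n ≤ M
    · have hn0 : (0 : ℝ) < n := by exact_mod_cast hn.1
      have hnM : (n : ℝ) ≤ M := by exact_mod_cast hn.2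
      have hy : y₀ ≤ Real.exp (t * r / n) := by
        refine hr.trans (Real.exp_le_exp.2 ?_)
        rw [le_div_iff₀ hn0]
        calc t / 2 * Real.sqrt r * n ≤ t / 2 * Real.sqrt r * (2 * Real.sqrt r) := by
              gcongr; linarith
          _ = t * Real.sqrt r ^ 2 := by ring
          _ = t * r := by rw [hsqsq]
      obtain ⟨C, W, hW, hcard, hcov, hint⟩ := hy₀ _ hy n
      refine ⟨C, W, hW, hcard.trans (le_of_eq ?_), hcov, fun h => absurd hn.2 (by omega),
        fun _ => hint.trans (le_of_eq ?_)⟩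
      · rw [← Real.exp_mul, ← Real.exp_nat_mul, ← htη]
        congr 1
        field_simp
      · rw [if_pos hn.2, ENNReal.ofReal_rpow_of_pos (by positivity),
          Real.div_rpow (by norm_num) (Real.exp_pos _).le, ← Real.exp_mul,
          show t * r / n * s = t * s * r / n by ring, Real.exp_neg, div_eq_mul_inv]
    · refine ⟨C₀, fun v => ENNReal.ofReal ‖v‖, ENNReal.measurable_ofReal.comp measurable_norm,
        ?_, coversJumps_zero, fun _ => rfl, fun h1 => ?_⟩
      · rw [hC₀, Finset.card_singleton, Nat.cast_one]
        exact Real.one_le_exp (by positivity)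
      · rw [if_neg fun h => hn ⟨h1, h⟩, mul_one]
        refine le_add_right le_rfl |>.trans (le_mul_of_one_le_left zero_le ?_)
        rw [ENNReal.one_le_ofReal]
        exact Real.one_le_rpow (by norm_num) hs.le
  choose C W hW hcard hcov hbig hint using hex
  refine ⟨C₀ ∪ (Finset.range (M + 1)).biUnion C, W, ⟨_, Finset.mem_union_left _
    (Finset.mem_singleton_self _)⟩, ?_, hW, fun n => ?_, hint⟩
  · have hpos : 0 < (C₀ ∪ (Finset.range (M + 1)).biUnion C).card :=
      Finset.card_pos.2 ⟨_, Finset.mem_union_left _ (Finset.mem_singleton_self _)⟩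
    rw [Real.log_le_iff_le_exp (by exact_mod_cast hpos)]
    have hE1 : 1 ≤ Real.exp ((1 + t) / 2 * r) := Real.one_le_exp (by positivity)
    have hsum : (((Finset.range (M + 1)).biUnion C).card : ℝ) ≤
        (M + 1) * Real.exp ((1 + t) / 2 * r) := by
      calc (((Finset.range (M + 1)).biUnion C).card : ℝ)
          ≤ ∑ n ∈ Finset.range (M + 1), ((C n).card : ℝ) := by
            exact_mod_cast Finset.card_biUnion_le
        _ ≤ ∑ _n ∈ Finset.range (M + 1), Real.exp ((1 + t) / 2 * r) :=
            Finset.sum_le_sum fun n _ => hcard n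
        _ = _ := by rw [Finset.sum_const, Finset.card_range, nsmul_eq_mul]; push_cast; ring
    calc ((C₀ ∪ (Finset.range (M + 1)).biUnion C).card : ℝ)
        ≤ (C₀.card : ℝ) + ((Finset.range (M + 1)).biUnion C).card := by
          exact_mod_cast Finset.card_union_le _ _
      _ ≤ Real.exp ((1 + t) / 2 * r) + (M + 1) * Real.exp ((1 + t) / 2 * r) := by
          rw [hC₀, Finset.card_singleton, Nat.cast_one]; gcongr
      _ = (M + 2) * Real.exp ((1 + t) / 2 * r) := by ring
      _ ≤ r * Real.exp ((1 + t) / 2 * r) := by gcongr; nlinarith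
      _ ≤ Real.exp ((1 - t) / 2 * r) * Real.exp ((1 + t) / 2 * r) := by gcongr
      _ = Real.exp r := by rw [← Real.exp_add]; congr 1; ring
  · rcases lt_or_ge M n with h | h
    · exact (hcov n).mono (by rw [hbig n h]; exact Finset.subset_union_left)
    · exact (hcov n).mono ((Finset.subset_biUnion_of_mem C
        (Finset.mem_range.2 (Nat.lt_succ_of_le h))).trans Finset.subset_union_right)

theorem IsCompoundPoisson.eventually_quantizationError_le [IsProbabilityMeasure P]
    (hX : IsCompoundPoisson P lam e Z X)
    (hlam : 0 < lam) {s : ℝ} (hs : 0 < s)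
    (h0 : quantizationDimension P (Z 0) (supDistortion d) s = 0) {K : ℝ} (hK0 : 0 < K)
    (hK : K < 1) :
    ∀ᶠ r in atTop, quantizationError P X (pathDistortion (supDistortion d)) s r ≤
      ENNReal.ofReal (Real.exp (-(K * quantizationRate s r))) := by
  obtain ⟨t, ht0, ht1, hKt⟩ : ∃ t : ℝ, 0 < t ∧ t < 1 ∧ K < t ^ 2 := by
    refine ⟨Real.sqrt ((K + 1) / 2), by positivity, ?_, ?_⟩
    · rw [Real.sqrt_lt' one_pos]; linarith
    · rw [Real.sq_sqrt (by positivity)]; linarith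
  set m := ∫⁻ ω, ENNReal.ofReal ‖Z 0 ω‖ ^ s ∂P + 1 with hm
  have hmtop : m ≠ ∞ :=
    ENNReal.add_ne_top.2 ⟨(lintegral_norm_rpow_lt_top hs h0).ne, ENNReal.one_ne_top⟩
  have hm1 : 1 ≤ m := le_add_self
  have hmr : 0 < m.toReal := ENNReal.toReal_pos (one_pos.trans_le hm1).ne' hmtop
  -- The factor `2` in `A` and in `c` makes the `n`-th term at most `2^(-(n+1))` times the target,
  -- so the series sums to it.
  filter_upwards [eventually_exists_common_codebook (hX.measurable_Z 0) hs h0 ht0 ht1,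
    eventually_jump_term_le (A := 2 * Real.exp lam) (c := 2 * (4 ^ s * m.toReal)) hs
      (by positivity) (by positivity) ht0 ht1 hKt]
    with r ⟨C, W, hC, hCr, hW, hcov, hint⟩ hterm
  refine (iInf_le_of_le C (iInf_le_of_le hC (iInf_le _ hCr))).trans ?_
  rw [one_div, ENNReal.rpow_inv_le_iff hs, ENNReal.ofReal_rpow_of_pos (Real.exp_pos _),
    ← Real.exp_mul]
  refine (hX.lintegral_iInf_le_tsum hlam hs hW hcov).trans ?_
  set G := Real.exp (-(K * quantizationRate s r) * s) with hG
  have hGeq : Real.exp (-(s * (K * quantizationRate s r))) = G := by rw [hG]; congr 1; ring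
  calc _ ≤ ∑' n : ℕ, (2⁻¹ : ℝ≥0∞) ^ (n + 1) * ENNReal.ofReal G := by
        refine ENNReal.tsum_le_tsum fun n => ?_
        rcases Nat.eq_zero_or_pos n with rfl | hn
        · simp
        have hn0 : (0 : ℝ) < n := by exact_mod_cast hn
        set q := if n ≤ ⌈Real.sqrt r⌉₊ then Real.exp (-(t * s * r / n)) else 1 with hq
        have hq0 : 0 ≤ q := by rw [hq]; split_ifs <;> positivity
        calc _ ≤ ENNReal.ofReal ((Real.exp lam / (n + 1)) ^ n) * ((n : ℝ≥0∞) ^ s *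
              (n * (ENNReal.ofReal (4 ^ s * q) * m))) := by
              gcongr
              · exact hX.measure_sum_e_le n
              · exact hint n hn
          _ = ENNReal.ofReal ((Real.exp lam / (n + 1)) ^ n * ((n : ℝ) ^ s *
              (n * ((4 ^ s * q) * m.toReal)))) := by
              rw [ENNReal.ofReal_mul (p := (Real.exp lam / (n + 1)) ^ n) (by positivity),
                ENNReal.ofReal_mul (p := (n : ℝ) ^ s) (by positivity),
                ENNReal.ofReal_mul (p := (n : ℝ)) (by positivity),
                ENNReal.ofReal_mul (p := 4 ^ s * q) (by positivity), ENNReal.ofReal_toReal hmtop,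
                ← ENNReal.ofReal_rpow_of_pos hn0, ENNReal.ofReal_natCast]
          _ ≤ ENNReal.ofReal ((1 / 2) ^ (n + 1) * G) := by
              refine ENNReal.ofReal_le_ofReal ?_
              have h := hterm n hn
              rw [← hq, hGeq, mul_div_assoc, mul_pow, Real.rpow_add hn0, Real.rpow_one] at h
              have h' := mul_le_mul_of_nonneg_left h
                (show (0 : ℝ) ≤ (1 / 2) ^ (n + 1) by positivity)
              refine le_trans (le_of_eq ?_) h'
              rw [pow_succ, one_div_pow]
              field_simp
          _ = _ := by
              rw [ENNReal.ofReal_mul (by positivity), ENNReal.ofReal_pow (by positivity), one_div,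
                ENNReal.ofReal_inv_of_pos two_pos, ENNReal.ofReal_ofNat]
    _ = ENNReal.ofReal G := by
        rw [ENNReal.tsum_mul_right]
        simp_rw [pow_succ]
        rw [ENNReal.tsum_mul_right, ENNReal.tsum_geometric, ENNReal.one_sub_inv_two, inv_inv,
          ENNReal.mul_inv_cancel two_ne_zero ENNReal.ofNat_ne_top, one_mul]

end UpperBound

/-! ### Passing to the extended real ratio -/

theorem asympLe_of_forall_eventually {D : ℝ → ℝ≥0∞} {g : ℝ → ℝ} (hg : ∀ᶠ r in atTop, 0 < g r)
    (h : ∀ K : ℝ, 1 < K → ∀ᶠ r in atTop, ENNReal.ofReal (Real.exp (-(K * g r))) ≤ D r) :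
    AsympLe (fun r => -ENNReal.log (D r)) fun r => (g r : EReal) := by
  refine EReal.le_of_forall_lt_iff_le.1 fun K hK => ?_
  refine limsup_le_of_le (by isBoundedDefault) ?_
  filter_upwards [hg, h K (by exact_mod_cast hK)] with r hr hD
  rw [EReal.div_le_iff_le_mul (by exact_mod_cast hr) (EReal.coe_ne_top _), EReal.neg_le,
    ← EReal.coe_mul, ← EReal.coe_neg, mul_comm]
  have := ENNReal.log_le_log hD
  rwa [ENNReal.log_ofReal_of_pos (Real.exp_pos _), Real.log_exp] at this

theorem one_le_liminf_of_forall_eventually {D : ℝ → ℝ≥0∞} {g : ℝ → ℝ}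
    (hg : ∀ᶠ r in atTop, 0 < g r)
    (h : ∀ K : ℝ, 0 < K → K < 1 →
      ∀ᶠ r in atTop, D r ≤ ENNReal.ofReal (Real.exp (-(K * g r)))) :
    1 ≤ liminf (fun r => -ENNReal.log (D r) / (g r : EReal)) atTop := by
  refine EReal.ge_of_forall_gt_iff_ge.1 fun K hK => ?_
  refine le_liminf_of_le (by isBoundedDefault) ?_
  have hK1 : K < 1 := by exact_mod_cast hK
  -- `K` may be negative or zero here, while `h` needs a positive constant.
  filter_upwards [hg, h (max K (1 / 2)) (by positivity) (max_lt hK1 (by norm_num))] with r hr hD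
  refine (EReal.coe_le_coe_iff.2 (le_max_left K (1 / 2))).trans ?_
  rw [EReal.le_div_iff_mul_le (by exact_mod_cast hr) (EReal.coe_ne_top _), EReal.le_neg,
    ← EReal.coe_mul, ← EReal.coe_neg]
  have := ENNReal.log_le_log hD
  rwa [ENNReal.log_ofReal_of_pos (Real.exp_pos _), Real.log_exp] at this

theorem mainTheorem9 {Ω : Type*} [MeasurableSpace Ω] (P : Measure Ω) [IsProbabilityMeasure P]
    (d : ℕ) (lam : ℝ) (hlam : 0 < lam) (s : ℝ) (hs : 0 < s)
    (e : ℕ → Ω → ℝ) (Z : ℕ → Ω → (Fin d → ℝ)) (X : Ω → StepPath (Fin d → ℝ))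
    (hX : IsCompoundPoisson P lam e Z X) :
    AsympLe
        (fun r => -ENNReal.log (quantizationError P X (pathDistortion (supDistortion d)) s r))
        (fun r => ((Real.sqrt (2 / s * (r * Real.log r)) : ℝ) : EReal)) ∧
      (quantizationDimension P (Z 0) (supDistortion d) s = 0 →
        AsympEq
          (fun r => -ENNReal.log (quantizationError P X (pathDistortion (supDistortion d)) s r))
          (fun r => ((Real.sqrt (2 / s * (r * Real.log r)) : ℝ) : EReal))) := by
  have hg : ∀ᶠ r in atTop, 0 < quantizationRate s r :=
    (tendsto_quantizationRate hs).eventually_gt_atTop 0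
  have hupper := asympLe_of_forall_eventually hg fun K hK =>
    hX.eventually_le_quantizationError hlam hs hK
  refine ⟨hupper, fun h0 => ?_⟩
  have hlower := one_le_liminf_of_forall_eventually hg fun K hK0 hK =>
    hX.eventually_quantizationError_le hlam hs h0 hK0 hK
  exact tendsto_of_le_liminf_of_limsup_le hlower hupper
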